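/- Let $\alpha>0$ be fixed. For $N\ge 1$ let $K_N$ be the complete graph with vertex set $\{0,1,\dots,N-1\}$, let $\beta=\alpha/N$, and let the arboreal gas on $K_N$ be the probability measure on the forests $F$ of $K_N$ (spanning subgraphs without cycles) $$\mathbb P_\beta[F]=\frac{\beta^{|F|}}{Z_\beta},\qquad Z_\beta=\sum_{F}\beta^{|F|},$$ where $|F|$ is the number of edges of $F$. Let $0\leftrightarrow 1$ be the event that $0$ and $1$ lie in the same tree of the forest, and let $T_0$ be the tree that contains $0$, with $|E(T_0)|$ edges and $|V(T_0)|=|E(T_0)|+1$ vertices. Write $f_N\sim g_N$ for $f_N/g_N\to1$ as $N\to\infty$, and let $c=3^{2/3}\,\Gamma(4/3)/\Gamma(2/3)$. (i) If $\alpha<1$, then $$Z_\beta\sim e^{N\alpha/2}\sqrt{1-\alpha},\qquad \mathbb P_\beta[0\leftrightarrow1]\sim\frac{\alpha}{1-\alpha}\,\frac1N,\qquad \mathbb E_\beta|E(T_0)|\sim\frac{\alpha}{1-\alpha},\qquad \mathbb E_\beta|V(T_0)|\sim\frac{1}{1-\alpha}.$$ (ii) If $\alpha>1$, then $$Z_\beta\sim\frac{\alpha^{N+3/2}\,e^{N/(2\alpha)}}{(\alpha-1)^{5/2}\,N},\qquad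 \mathbb P_\beta[0\leftrightarrow1]\sim\Big(\frac{\alpha-1}{\alpha}\Big)^2,\qquad \mathbb E_\beta|E(T_0)|\sim\mathbb E_\beta|V(T_0)|\sim\Big(\frac{\alpha-1}{\alpha}\Big)^2N.$$ (iii) If $\alpha=1$, then $$Z_\beta\sim\frac{3^{1/6}\,\Gamma(2/3)\,e^{N/2}}{N^{1/6}\sqrt{2\pi}},\qquad \mathbb P_\beta[0\leftrightarrow1]\sim c\,N^{-2/3},\qquad \mathbb E_\beta|E(T_0)|\sim\mathbb E_\beta|V(T_0)|\sim c\,N^{1/3}.$$ -/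

import Mathlib

open Filter Asymptotics

noncomputable section

namespace ArborealGas

variable {V : Type*} [Fintype V]

open Classical in
/-- The forests of a finite graph `G`: the spanning subgraphs of `G` (same vertex set, a subset of
the edges) that contain no cycle. -/
def forests (G : SimpleGraph V) : Finset (SimpleGraph V) :=
  Finset.univ.filter fun F => F ≤ G ∧ F.IsAcyclic

/-- The weight `β ^ |F|` of a forest, where `|F|` is its number of edges. -/
def weight (β : ℝ) (F : SimpleGraph V) : ℝ :=
  β ^ F.edgeSet.ncard

/-- The partition function `Z_β = ∑_F β ^ |F|` of the arboreal gas on `G`. -/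
def partitionFunction (G : SimpleGraph V) (β : ℝ) : ℝ :=
  ∑ F ∈ forests G, weight β F

/-- The probability `ℙ_β[F] = β ^ |F| / Z_β` of a single forest (and `0` for a graph that is not a
forest of `G`). -/
def pmf (G : SimpleGraph V) (β : ℝ) : SimpleGraph V → ℝ :=
  (forests G : Set (SimpleGraph V)).indicator fun F => weight β F / partitionFunction G β

/-- The expectation `𝔼_β[f]` of an observable of the forest. -/
def expect (G : SimpleGraph V) (β : ℝ) (f : SimpleGraph V → ℝ) : ℝ :=
  ∑ F ∈ forests G, pmf G β F * f F

/-- The probability `ℙ_β[A]` of an event. -/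
def prob (G : SimpleGraph V) (β : ℝ) (A : Set (SimpleGraph V)) : ℝ :=
  expect G β (A.indicator 1)

/-- The connection probability `ℙ_β[i ↔ j]`: `i` and `j` lie in the same tree of the forest. -/
def connProb (G : SimpleGraph V) (β : ℝ) (i j : V) : ℝ :=
  prob G β {F | F.Reachable i j}

/-- The tree `T_i` of the forest `F` that contains the vertex `i`, as a graph on the vertices of the
connected component of `i`. -/
def treeAt (F : SimpleGraph V) (i : V) : SimpleGraph (F.connectedComponentMk i) :=
  (F.connectedComponentMk i).toSimpleGraph

/-- The expected number of edges of the tree `T_i`. -/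
def expectedTreeEdges (G : SimpleGraph V) (β : ℝ) (i : V) : ℝ :=
  expect G β fun F => ((treeAt F i).edgeSet.ncard : ℝ)

/-- The expected number of vertices of the tree `T_i`. -/
def expectedTreeVertices (G : SimpleGraph V) (β : ℝ) (i : V) : ℝ :=
  expect G β fun F => (Nat.card (F.connectedComponentMk i) : ℝ)

end ArborealGas

end

/-! Both the partition function and the mean tree size on `K_N` are Hermite polynomials in disguise.
For a vertex set `S` let A(S) be the weighted number of forests that separate the vertices of `S`,
and let B(S) be the same sum weighted by the size of the tree of one vertex of `S`. Two identities
link them. Cutting the first edge on the path from a new vertex `v` to `S` expresses A(S) through A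
and B at `S ∪ {v}` (`sepSum_eq_add`). Assigning each vertex to the tree of an element of `S`, or to
none, expresses B(S) through A (`sum_sepTreeSum`). By symmetry only |S| matters, and with s = N -
|S| the recursion is solved by B = H_s and A = H_s - sβ H_{s-1}, where H is `hermiteSeq` with mean 1
+ Nβ and variance β (`sepSum_closed_form`). Hence Z = H_N - Nβ H_{N-1} and E|V(T_0)| = H_{N-1} / Z.
The edge count is one less, and the connection probability is (E|V(T_0)| - 1)/(N - 1).

H_n is the integral of w^n against a Gaussian on any vertical line (`integral_line`). Thus H_{N-1}
and Z are integrals of e^{Nφ(w)} times 1/w and 1 - α/w, with φ(w) = log w + (w - 1 - α)²/(2α). Since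
φ'(w) = (w - 1)(w - α)/(αw), the saddles are 1 and α, and the larger one is a nondegenerate maximum
of |e^φ| along its vertical line. For α < 1 Laplace's method at 1 gives both sums. For α > 1 the
saddle is α, where 1 - α/w vanishes; an integration by parts (`integral_by_parts`) extracts the
factor 1/N that Z loses. At α = 1 the saddles merge, φ(1 + z) = 1/2 + z³/3 + O(z⁴), and on the scale
N^{-1/3} there remain Airy-type integrals. Rotating their contour to the ray of angle π/3 turns them
into Gamma values (`integral_critical`). -/

noncomputable section

namespace ArborealGas

/-! ### Joining two trees by an edge, and cutting such an edge -/

section Edge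

variable {V : Type*} {F F₁ F₂ : SimpleGraph V} {v u i x y : V}

/-- A walk that starts outside the component of `v` can first use the new edge only from `u` to `v`;
if it later crosses back to `u`, it is again in the component of `x`. -/
lemma reachable_of_reachable_sup_edge (hx : ¬ F.Reachable x v)
    (h : (F ⊔ SimpleGraph.edge v u).Reachable x y) :
    F.Reachable x y ∨ (F.Reachable x u ∧ F.Reachable v y) := by
  rw [SimpleGraph.reachable_iff_reflTransGen] at h
  induction h with
  | refl => exact Or.inl (SimpleGraph.Reachable.refl _)
  | @tail b c _ hbc ih =>
    rw [SimpleGraph.sup_adj, SimpleGraph.edge_adj] at hbc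
    rcases hbc with hbc | ⟨⟨rfl, rfl⟩ | ⟨rfl, rfl⟩, -⟩
    · rcases ih with h | ⟨h1, h2⟩
      · exact Or.inl (h.trans hbc.reachable)
      · exact Or.inr ⟨h1, h2.trans hbc.reachable⟩
    · rcases ih with h | ⟨h1, h2⟩
      · exact absurd h hx
      · exact Or.inl h1
    · rcases ih with h | ⟨h1, h2⟩
      · exact Or.inr ⟨h, SimpleGraph.Reachable.refl _⟩
      · exact Or.inr ⟨h1, SimpleGraph.Reachable.refl _⟩

/-- A walk from `i` in `F₁` never meets `v`, so none of its edges is the added edge of the other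
decomposition, and all of them lie in `F₂`. -/
lemma reachable_of_sup_edge_eq {u₁ u₂ : V} (h : F₁ ⊔ SimpleGraph.edge v u₁ = F₂ ⊔ SimpleGraph.edge v u₂)
    (hv : ¬ F₁.Reachable i v) (hx : F₁.Reachable i x) : F₂.Reachable i x := by
  rw [SimpleGraph.reachable_iff_reflTransGen] at hx
  induction hx with
  | refl => exact SimpleGraph.Reachable.refl _
  | @tail b c hb hbc ih =>
    refine ih.trans ?_
    rw [← SimpleGraph.reachable_iff_reflTransGen] at hb
    have hc := hb.trans hbc.reachable
    have : (F₂ ⊔ SimpleGraph.edge v u₂).Adj b c := by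
      rw [← h]; exact Or.inl hbc
    rw [SimpleGraph.sup_adj, SimpleGraph.edge_adj] at this
    rcases this with h | ⟨⟨rfl, rfl⟩ | ⟨rfl, rfl⟩, -⟩
    · exact h.reachable
    · exact absurd hb hv
    · exact absurd hc hv

/-- Injectivity of the gluing map. If `u₁ ≠ u₂`, the edge from `v` to `u₁` belongs to `F₂` and joins
`v` to `i` there. Once the added edges agree, deleting them recovers the two graphs. -/
lemma eq_of_sup_edge_eq {u₁ u₂ : V} (h : F₁ ⊔ SimpleGraph.edge v u₁ = F₂ ⊔ SimpleGraph.edge v u₂)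
    (h₁ : ¬ F₁.Reachable i v) (h₂ : ¬ F₂.Reachable i v) (hu₁ : F₁.Reachable i u₁)
    (hu₂ : F₂.Reachable i u₂) : F₁ = F₂ ∧ u₁ = u₂ := by
  have hne : v ≠ u₁ := by rintro rfl; exact h₁ hu₁
  have hu : u₁ = u₂ := by
    by_contra hne'
    have : (F₂ ⊔ SimpleGraph.edge v u₂).Adj v u₁ := by
      rw [← h, SimpleGraph.sup_adj, SimpleGraph.edge_adj]; simp [hne]
    rw [SimpleGraph.sup_adj, SimpleGraph.edge_adj] at this
    have hadj : F₂.Adj v u₁ := by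
      rcases this with h | ⟨⟨-, h⟩ | ⟨h, h'⟩, -⟩
      · exact h
      · exact absurd h hne'
      · exact absurd h' hne.symm
    exact h₂ ((reachable_of_sup_edge_eq h h₁ hu₁).trans hadj.symm.reachable)
  subst hu
  refine ⟨?_, rfl⟩
  have e : ∀ {F : SimpleGraph V}, ¬ F.Reachable i v → F.Reachable i u₁ →
      (F ⊔ SimpleGraph.edge v u₁) \ SimpleGraph.edge v u₁ = F := by
    intro F hv hu
    rw [sup_sdiff_right_self, sdiff_eq_left]
    rw [disjoint_iff_inf_le]
    intro a b hab
    rw [SimpleGraph.inf_adj, SimpleGraph.edge_adj] at hab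
    obtain ⟨hab, ⟨rfl, rfl⟩ | ⟨rfl, rfl⟩, -⟩ := hab
    · exact (hv (hu.trans hab.symm.reachable)).elim
    · exact (hv (hu.trans hab.reachable)).elim
  rw [← e h₁ hu₁, ← e h₂ hu₂, h]

/-- Surjectivity of the gluing map. The first edge of a path from `v` to `i` is a bridge because `F`
is acyclic, and the rest of the path avoids it because a path does not return to `v`. -/
lemma exists_sup_edge (hF : F.IsAcyclic) (hvi : F.Reachable v i) (hne : v ≠ i) :
    ∃ (F' : SimpleGraph V) (u : V), F' ≤ F ∧ ¬ F'.Reachable v i ∧ F'.Reachable i u ∧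
      F' ⊔ SimpleGraph.edge v u = F := by
  obtain ⟨p, hp⟩ := hvi.exists_isPath
  cases p with
  | nil => exact absurd rfl hne
  | @cons _ u _ hadj p =>
    rw [SimpleGraph.Walk.cons_isPath_iff] at hp
    have hbr := SimpleGraph.isAcyclic_iff_forall_adj_isBridge.1 hF hadj
    rw [SimpleGraph.isBridge_iff] at hbr
    have hui : (F \ SimpleGraph.fromEdgeSet {s(v, u)}).Reachable u i := by
      refine ⟨p.transfer _ fun e he => ?_⟩
      rw [SimpleGraph.edgeSet_sdiff, Set.mem_sdiff]
      refine ⟨p.edges_subset_edgeSet he, fun h => ?_⟩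
      have : e = s(v, u) := by
        rw [SimpleGraph.edgeSet_fromEdgeSet] at h
        exact h.1
      subst this
      exact hp.2 (p.fst_mem_support_of_mem_edges he)
    refine ⟨F \ SimpleGraph.fromEdgeSet {s(v, u)}, u, sdiff_le, fun h => hbr ?_, hui.symm, ?_⟩
    · exact h.trans hui.symm
    · ext a b
      simp only [SimpleGraph.sup_adj, SimpleGraph.sdiff_adj, SimpleGraph.edge_adj,
        SimpleGraph.fromEdgeSet_adj, Set.mem_singleton_iff, Sym2.eq_iff]
      constructor
      · rintro (h | ⟨⟨rfl, rfl⟩ | ⟨rfl, rfl⟩, -⟩)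
        · exact h.1
        · exact hadj
        · exact hadj.symm
      · intro h
        have := h.ne
        tauto

end Edge

/-! ### Forests that separate a vertex set, and their two recurrences -/

lemma weight_map (β : ℝ) {V : Type*} (σ : Equiv.Perm V) (F : SimpleGraph V) :
    weight β (F.map σ) = weight β F := by
  have : (F.map σ).edgeSet = σ.toEmbedding.sym2Map '' F.edgeSet :=
    SimpleGraph.edgeSet_map σ.toEmbedding F
  rw [weight, weight, this, Set.ncard_image_of_injective _ σ.toEmbedding.sym2Map.injective]

lemma reachable_map {V : Type*} (σ : Equiv.Perm V) (F : SimpleGraph V) (x y : V) :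
    (F.map σ).Reachable (σ x) (σ y) ↔ F.Reachable x y :=
  SimpleGraph.Iso.reachable_iff (φ := SimpleGraph.Iso.map σ F)

variable {V : Type*} [Fintype V]

open Classical in
/-- The forests on `V` in which the vertices of `S` lie in pairwise different trees. -/
def sepForests (S : Finset V) : Finset (SimpleGraph V) :=
  (forests ⊤).filter fun F => (S : Set V).Pairwise fun x y => ¬ F.Reachable x y

open Classical in
/-- The vertices of the tree that contains `i`. -/
def treeVerts (F : SimpleGraph V) (i : V) : Finset V :=
  Finset.univ.filter fun u => F.Reachable i u

/-- The weighted number of forests that separate `S`. -/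
def sepSum (β : ℝ) (S : Finset V) : ℝ := ∑ F ∈ sepForests S, weight β F

/-- The weighted sum, over the forests that separate `S`, of the size of the tree of `i`. -/
def sepTreeSum (β : ℝ) (S : Finset V) (i : V) : ℝ :=
  ∑ F ∈ sepForests S, weight β F * (treeVerts F i).card

lemma mem_forests_top {F : SimpleGraph V} : F ∈ forests (⊤ : SimpleGraph V) ↔ F.IsAcyclic := by
  simp [forests]

lemma mem_sepForests {S : Finset V} {F : SimpleGraph V} :
    F ∈ sepForests S ↔ F.IsAcyclic ∧ (S : Set V).Pairwise fun x y => ¬ F.Reachable x y := by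
  simp [sepForests, mem_forests_top]

lemma mem_treeVerts {F : SimpleGraph V} {i u : V} : u ∈ treeVerts F i ↔ F.Reachable i u := by
  simp [treeVerts]

lemma weight_sup_edge (β : ℝ) {F : SimpleGraph V} {v u : V} (h : ¬ F.Reachable v u) :
    weight β (F ⊔ SimpleGraph.edge v u) = β * weight β F := by
  have hne : v ≠ u := by rintro rfl; exact h (SimpleGraph.Reachable.refl _)
  have hnot : s(v, u) ∉ F.edgeSet := fun h' => h (SimpleGraph.Adj.reachable h')
  have : (F ⊔ SimpleGraph.edge v u).edgeSet = insert s(v, u) F.edgeSet := by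
    rw [SimpleGraph.edgeSet_sup, SimpleGraph.edgeSet_edge_of_ne hne, Set.union_singleton]
  rw [weight, weight, this, Set.ncard_insert_of_notMem hnot (Set.toFinite _), pow_succ']

open Classical in
/-- Cutting the first edge of the path from `v` to `i`. -/
lemma sum_reachable_eq [DecidableEq V] (β : ℝ) {S : Finset V} {v i : V} (hv : v ∉ S) (hi : i ∈ S) :
    ∑ F ∈ sepForests S with F.Reachable v i, weight β F = β * sepTreeSum β (insert v S) i := by
  have hvi : v ≠ i := by rintro rfl; exact hv hi
  have hsep : ∀ {F : SimpleGraph V}, ((insert v S : Finset V) : Set V).Pairwise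
      (fun x y => ¬ F.Reachable x y) ↔
      (S : Set V).Pairwise (fun x y => ¬ F.Reachable x y) ∧ ∀ x ∈ S, ¬ F.Reachable x v := by
    intro F
    rw [Finset.coe_insert, Set.pairwise_insert]
    refine and_congr_right fun _ => forall₂_congr fun x hx => ?_
    have : v ≠ x := by rintro rfl; exact hv hx
    simp [this, SimpleGraph.reachable_comm (u := v)]
  -- The tree size counts the possible endpoints `u` of the cut edge, so the right side is a sum
  -- over pairs (forest, `u` in the tree of `i`), matched with forests by gluing `v` to `u`.
  have e : β * sepTreeSum β (insert v S) i =
      ∑ p ∈ (sepForests (insert v S)).sigma fun F => treeVerts F i, β * weight β p.1 := by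
    rw [Finset.sum_sigma, sepTreeSum, Finset.mul_sum]
    refine Finset.sum_congr rfl fun F _ => ?_
    dsimp only
    rw [Finset.sum_const, nsmul_eq_mul]
    ring
  rw [e]
  symm
  refine Finset.sum_bij (fun p _ => p.1 ⊔ SimpleGraph.edge v p.2) ?_ ?_ ?_ ?_
  · rintro ⟨F, u⟩ hp
    rw [Finset.mem_sigma, mem_sepForests, hsep, mem_treeVerts] at hp
    obtain ⟨⟨hF, hS, hSv⟩, hu⟩ := hp
    dsimp only at hF hS hSv hu ⊢
    have hvu : ¬ F.Reachable v u := fun h => hSv i hi (hu.trans h.symm)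
    have hne : v ≠ u := by rintro rfl; exact hvu (SimpleGraph.Reachable.refl _)
    rw [Finset.mem_filter, mem_sepForests]
    refine ⟨⟨hF.sup_edge_of_not_reachable hvu, fun x hx y hy hxy h => ?_⟩, ?_⟩
    · rcases reachable_of_reachable_sup_edge (hSv x hx) h with h | ⟨-, h⟩
      · exact hS hx hy hxy h
      · exact hSv y hy h.symm
    · have h1 : (F ⊔ SimpleGraph.edge v u).Adj v u := by
        rw [SimpleGraph.sup_adj, SimpleGraph.edge_adj]; simp [hne]
      exact h1.reachable.trans (hu.mono le_sup_left).symm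
  · rintro ⟨F₁, u₁⟩ h₁ ⟨F₂, u₂⟩ h₂ h
    rw [Finset.mem_sigma, mem_sepForests, hsep, mem_treeVerts] at h₁ h₂
    obtain ⟨rfl, rfl⟩ := eq_of_sup_edge_eq h (h₁.1.2.2 i hi) (h₂.1.2.2 i hi) h₁.2 h₂.2
    rfl
  · intro F hF
    rw [Finset.mem_filter, mem_sepForests] at hF
    obtain ⟨⟨hF, hS⟩, hr⟩ := hF
    obtain ⟨F', u, hle, h1, h2, h3⟩ := exists_sup_edge hF hr hvi
    refine ⟨⟨F', u⟩, ?_, h3⟩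
    rw [Finset.mem_sigma, mem_sepForests, hsep, mem_treeVerts]
    refine ⟨⟨hF.anti hle, fun x hx y hy hxy h => hS hx hy hxy (h.mono hle), fun x hx h => ?_⟩, h2⟩
    by_cases hxi : x = i
    · exact h1 (hxi ▸ h.symm)
    · exact hS hx hi hxi ((h.mono hle).trans hr)
  · rintro ⟨F, u⟩ hp
    rw [Finset.mem_sigma, mem_sepForests, hsep, mem_treeVerts] at hp
    exact (weight_sup_edge β fun h => hp.1.2.2 i hi (hp.2.trans h.symm)).symm

open Classical in
-- In a forest separating `S`, the vertex `v` is either separated from all of `S` or lies in the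
-- tree of exactly one `i ∈ S`; `sum_reachable_eq` evaluates the latter contributions.
lemma sepSum_eq_add [DecidableEq V] (β : ℝ) {S : Finset V} {v : V} (hv : v ∉ S) :
    sepSum β S = sepSum β (insert v S) + β * ∑ i ∈ S, sepTreeSum β (insert v S) i := by
  have key : ∀ F ∈ sepForests S, weight β F =
      (if F ∈ sepForests (insert v S) then weight β F else 0) +
        ∑ i ∈ S, if F.Reachable v i then weight β F else 0 := by
    intro F hF
    rw [mem_sepForests] at hF
    by_cases h : ∃ i ∈ S, F.Reachable v i
    · obtain ⟨i, hi, hr⟩ := h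
      have hvi : v ≠ i := by rintro rfl; exact hv hi
      rw [if_neg, Finset.sum_eq_single_of_mem i hi, if_pos hr, zero_add]
      · intro j hj hji
        exact if_neg fun h => hF.2 hj hi hji (h.symm.trans hr)
      · rw [mem_sepForests]
        exact fun h => h.2 (by simp) (by simp [hi]) hvi hr
    · push Not at h
      rw [if_pos, Finset.sum_eq_zero fun i hi => if_neg (h i hi), add_zero]
      rw [mem_sepForests, Finset.coe_insert, Set.pairwise_insert]
      exact ⟨hF.1, hF.2, fun x hx _ => ⟨h x hx, fun h' => h x hx h'.symm⟩⟩
  rw [sepSum, Finset.sum_congr rfl key, Finset.sum_add_distrib, Finset.mul_sum]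
  congr 1
  · rw [← Finset.sum_filter, sepSum]
    refine Finset.sum_congr ?_ fun _ _ => rfl
    ext F
    simp only [Finset.mem_filter, mem_sepForests, and_iff_right_iff_imp]
    exact fun h => ⟨h.1, h.2.mono (by simp)⟩
  · rw [Finset.sum_comm]
    refine Finset.sum_congr rfl fun i hi => ?_
    rw [← Finset.sum_filter, sum_reachable_eq β hv hi]

open Classical in
-- Double counting of vertices: in a forest separating `S`, the trees of the elements of `S` are
-- disjoint, and a vertex `u` outside all of them is exactly one for which `insert u S` is still
-- separated.
lemma sum_sepTreeSum [DecidableEq V] (β : ℝ) (S : Finset V) :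
    ∑ i ∈ S, sepTreeSum β S i =
      Fintype.card V * sepSum β S - ∑ u ∈ Sᶜ, sepSum β (insert u S) := by
  have key : ∀ F ∈ sepForests S, ∀ u : V, (1 : ℝ) =
      (if u ∈ Sᶜ then (if F ∈ sepForests (insert u S) then 1 else 0) else 0) +
        ∑ i ∈ S, if F.Reachable i u then 1 else 0 := by
    intro F hF u
    rw [mem_sepForests] at hF
    by_cases h : ∃ i ∈ S, F.Reachable i u
    · obtain ⟨i, hi, hr⟩ := h
      rw [Finset.sum_eq_single_of_mem i hi, if_pos hr]
      · by_cases huS : u ∈ S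
        · simp [huS]
        · rw [if_neg (c := F ∈ _), ite_self, zero_add]
          rw [mem_sepForests]
          exact fun h => h.2 (by simp [hi]) (by simp) (by rintro rfl; exact huS hi) hr
      · intro j hj hji
        exact if_neg fun h => hF.2 hj hi hji (h.trans hr.symm)
    · push Not at h
      have huS : u ∉ S := fun hu => h u hu (SimpleGraph.Reachable.refl _)
      rw [if_pos (by simpa using huS), if_pos, Finset.sum_eq_zero fun i hi => if_neg (h i hi),
        add_zero]
      rw [mem_sepForests, Finset.coe_insert, Set.pairwise_insert]
      exact ⟨hF.1, hF.2, fun x hx _ => ⟨fun h' => h x hx h'.symm, h x hx⟩⟩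
  have hcard : ∀ F ∈ sepForests S, weight β F * (Fintype.card V : ℝ) =
      (∑ u ∈ Sᶜ, if F ∈ sepForests (insert u S) then weight β F else 0) +
        ∑ i ∈ S, weight β F * (treeVerts F i).card := by
    intro F hF
    have h1 : (Fintype.card V : ℝ) = ∑ u : V, (1 : ℝ) := by simp
    rw [h1, Finset.sum_congr rfl fun u _ => key F hF u, Finset.sum_add_distrib, mul_add]
    congr 1
    · rw [← Finset.sum_filter, Finset.filter_univ_mem, Finset.mul_sum]
      exact Finset.sum_congr rfl fun u _ => by simp
    · rw [Finset.sum_comm, Finset.mul_sum]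
      refine Finset.sum_congr rfl fun i _ => ?_
      rw [treeVerts, Finset.sum_boole]
      congr!
  rw [eq_sub_iff_add_eq, sepSum, mul_comm, Finset.sum_mul, Finset.sum_congr rfl hcard,
    Finset.sum_add_distrib, add_comm, Finset.sum_comm (s := sepForests S) (t := S)]
  congr 1
  rw [Finset.sum_comm]
  refine Finset.sum_congr rfl fun u _ => ?_
  rw [← Finset.sum_filter, sepSum]
  refine Finset.sum_congr ?_ fun _ _ => rfl
  ext F
  simp only [Finset.mem_filter, mem_sepForests]
  constructor
  · exact fun h => ⟨⟨h.1, h.2.mono (by simp)⟩, h⟩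
  · exact fun h => h.2

/-! ### Invariance under permutations of the vertices -/

section Symmetry

lemma map_mem_sepForests (σ : Equiv.Perm V) {F : SimpleGraph V} {S : Finset V} :
    F.map σ ∈ sepForests (S.map σ.toEmbedding) ↔ F ∈ sepForests S := by
  rw [mem_sepForests, mem_sepForests, ← (SimpleGraph.Iso.map σ F).isAcyclic_iff, Finset.coe_map]
  refine and_congr_right fun _ => ?_
  constructor
  · intro h x hx y hy hxy hr
    exact h ⟨x, hx, rfl⟩ ⟨y, hy, rfl⟩ (by simpa using hxy) ((reachable_map σ F x y).2 hr)
  · rintro h _ ⟨x, hx, rfl⟩ _ ⟨y, hy, rfl⟩ hxy hr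
    exact h hx hy (by rintro rfl; exact hxy rfl) ((reachable_map σ F x y).1 hr)

lemma sum_sepForests_map (σ : Equiv.Perm V) (S : Finset V) (f : SimpleGraph V → ℝ) :
    ∑ F ∈ sepForests (S.map σ.toEmbedding), f F =
      ∑ F ∈ sepForests S, f (F.map σ) := by
  symm
  refine Finset.sum_bij (fun F _ => F.map σ)
    (fun F hF => (map_mem_sepForests σ).2 hF)
    (fun F₁ _ F₂ _ h => SimpleGraph.map_injective σ.toEmbedding h) (fun F hF => ?_) fun _ _ => rfl
  have e : (F.map σ.symm).map σ = F := by
    rw [SimpleGraph.map_map]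
    have : (σ : V → V) ∘ σ.symm = id := by ext; simp
    rw [this, SimpleGraph.map_id]
  exact ⟨F.map σ.symm, (map_mem_sepForests σ).1 (by rwa [e]), e⟩

lemma sepSum_map (β : ℝ) (σ : Equiv.Perm V) (S : Finset V) :
    sepSum β (S.map σ.toEmbedding) = sepSum β S := by
  rw [sepSum, sum_sepForests_map]
  exact Finset.sum_congr rfl fun F _ => weight_map β σ F

lemma sepTreeSum_map (β : ℝ) (σ : Equiv.Perm V) (S : Finset V) (i : V) :
    sepTreeSum β (S.map σ.toEmbedding) (σ i) = sepTreeSum β S i := by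
  rw [sepTreeSum, sum_sepForests_map]
  refine Finset.sum_congr rfl fun F _ => ?_
  have : treeVerts (F.map σ) (σ i) = (treeVerts F i).map σ.toEmbedding := by
    ext u
    obtain ⟨u, rfl⟩ := σ.surjective u
    rw [mem_treeVerts, reachable_map]
    simp [mem_treeVerts]
  rw [weight_map, this, Finset.card_map]

lemma sepSum_insert_comm [DecidableEq V] (β : ℝ) {S : Finset V} {u v : V} (hu : u ∉ S) (hv : v ∉ S) :
    sepSum β (insert u S) = sepSum β (insert v S) := by
  rw [← sepSum_map β (Equiv.swap u v)]
  congr 1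
  rw [Finset.map_insert]
  simp only [Equiv.coe_toEmbedding, Equiv.swap_apply_left]
  congr 1
  ext x
  simp only [Finset.mem_map, Equiv.coe_toEmbedding]
  constructor
  · rintro ⟨y, hy, rfl⟩
    rwa [Equiv.swap_apply_of_ne_of_ne (by rintro rfl; exact hu hy) (by rintro rfl; exact hv hy)]
  · intro hx
    exact ⟨x, hx, Equiv.swap_apply_of_ne_of_ne (by rintro rfl; exact hu hx)
      (by rintro rfl; exact hv hx)⟩

lemma sepTreeSum_comm (β : ℝ) {S : Finset V} {i j : V} (hi : i ∈ S) (hj : j ∈ S) :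
    sepTreeSum β S i = sepTreeSum β S j := by
  classical
  rw [← sepTreeSum_map β (Equiv.swap i j), Equiv.swap_apply_left]
  congr 1
  ext x
  simp only [Finset.mem_map, Equiv.coe_toEmbedding]
  have h : ∀ y, y ∈ S → Equiv.swap i j y ∈ S := by
    intro y hy
    rw [Equiv.swap_apply_def]
    split_ifs <;> assumption
  constructor
  · rintro ⟨y, hy, rfl⟩
    exact h y hy
  · intro hx
    exact ⟨_, h x hx, Equiv.swap_apply_self _ _ _⟩

end Symmetry

end ArborealGas
end

/-! ### Hermite closed forms on the complete graph -/

noncomputable section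

namespace ArborealGas

/-- The monic orthogonal polynomials of Hermite type, evaluated at `m`, with variance `b`. -/
def hermiteSeq (m b : ℝ) : ℕ → ℝ
  | 0 => 1
  | 1 => m
  | n + 2 => m * hermiteSeq m b (n + 1) - (n + 1) * b * hermiteSeq m b n

/-- The first `r` vertices. -/
def initialSeg (N r : ℕ) : Finset (Fin N) := Finset.univ.filter fun i => (i : ℕ) < r

section

variable {N : ℕ}

lemma mem_initialSeg {r : ℕ} {i : Fin N} : i ∈ initialSeg N r ↔ (i : ℕ) < r := by
  simp [initialSeg]

lemma initialSeg_succ {r : ℕ} (h : r < N) :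
    initialSeg N (r + 1) = insert ⟨r, h⟩ (initialSeg N r) := by
  ext i
  rw [Finset.mem_insert, mem_initialSeg, mem_initialSeg, Fin.ext_iff]
  dsimp only
  omega

lemma card_initialSeg {r : ℕ} (h : r ≤ N) : (initialSeg N r).card = r := by
  induction r with
  | zero => simp [initialSeg]
  | succ r ih =>
    rw [initialSeg_succ h, Finset.card_insert_of_notMem (by simp [mem_initialSeg]), ih (by omega)]

lemma sepSum_initialSeg_succ (β : ℝ) {r : ℕ} (h : r < N) :
    sepSum β (initialSeg N r) = sepSum β (initialSeg N (r + 1)) +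
      β * (r * sepTreeSum β (initialSeg N (r + 1)) ⟨0, by omega⟩) := by
  rw [sepSum_eq_add β (v := ⟨r, h⟩) (by simp [mem_initialSeg])]
  rw [← initialSeg_succ h]
  congr 2
  rw [Finset.sum_congr rfl fun i hi => sepTreeSum_comm β (S := initialSeg N (r + 1)) (i := i)
    (j := ⟨0, by omega⟩) (by rw [mem_initialSeg] at hi ⊢; omega) (by rw [mem_initialSeg]; simp),
    Finset.sum_const, card_initialSeg h.le, nsmul_eq_mul]

/-- The counting identity after symmetrization. For `r + 1 = N` the last coefficient is zero, so the
segment of length `r + 2 > N` is harmless. -/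
lemma mul_sepTreeSum_initialSeg (β : ℝ) {r : ℕ} (h : r < N) :
    (r + 1) * sepTreeSum β (initialSeg N (r + 1)) ⟨0, by omega⟩ =
      N * sepSum β (initialSeg N (r + 1)) - (N - (r + 1)) * sepSum β (initialSeg N (r + 2)) := by
  have h1 := sum_sepTreeSum β (initialSeg N (r + 1))
  rw [Finset.sum_congr rfl fun i hi => sepTreeSum_comm β (i := i) (j := ⟨0, by omega⟩) hi
    (by rw [mem_initialSeg]; simp), Finset.sum_const, card_initialSeg h, nsmul_eq_mul] at h1
  have h2 : ∀ u ∈ (initialSeg N (r + 1))ᶜ,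
      sepSum β (insert u (initialSeg N (r + 1))) = sepSum β (initialSeg N (r + 2)) := by
    intro u hu
    rw [Finset.mem_compl] at hu
    have hN : r + 1 < N := by rw [mem_initialSeg] at hu; omega
    rw [initialSeg_succ (r := r + 1) hN]
    exact sepSum_insert_comm β hu (by simp [mem_initialSeg])
  have h3 : ((initialSeg N (r + 1))ᶜ.card : ℝ) = N - (r + 1) := by
    rw [Finset.card_compl, card_initialSeg h, Fintype.card_fin, Nat.cast_sub h]
    push_cast; ring
  have h4 : ∑ u ∈ (initialSeg N (r + 1))ᶜ, sepSum β (insert u (initialSeg N (r + 1))) =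
      (N - (r + 1)) * sepSum β (initialSeg N (r + 2)) := by
    rw [Finset.sum_congr rfl h2, Finset.sum_const, nsmul_eq_mul, h3]
  rw [Fintype.card_fin] at h1
  rw [← h4]
  push_cast at h1
  rw [h1]

lemma sepSum_univ {V : Type*} [Fintype V] (β : ℝ) : sepSum β (Finset.univ : Finset V) = 1 := by
  have : sepForests (Finset.univ : Finset V) = {⊥} := by
    ext F
    rw [mem_sepForests, Finset.mem_singleton]
    constructor
    · rintro ⟨-, h⟩
      rw [eq_bot_iff]
      intro x y hxy
      exact (h (by simp) (by simp) hxy.ne hxy.reachable).elim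
    · rintro rfl
      exact ⟨SimpleGraph.isAcyclic_bot, fun x _ y _ hxy h => hxy (SimpleGraph.reachable_bot.1 h)⟩
  simp [sepSum, this, weight]

lemma sepSum_initialSeg_self (β : ℝ) : sepSum β (initialSeg N N) = 1 := by
  rw [← sepSum_univ (V := Fin N) β]
  congr 1
  ext i
  simp [mem_initialSeg]

/-- Closed forms for the separated forest sums on the complete graph. -/
lemma sepSum_closed_form (β : ℝ) (s : ℕ) : ∀ (r : ℕ) (_ : r + s = N),
    sepSum β (initialSeg N r) = hermiteSeq (1 + N * β) β s -
      s * β * hermiteSeq (1 + N * β) β (s - 1) ∧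
    ∀ h : 0 < r, sepTreeSum β (initialSeg N r) ⟨0, by omega⟩ = hermiteSeq (1 + N * β) β s := by
  -- The cutting recurrence gives the forest sum from both sums at `s - 1`; the counting identity
  -- then gives the tree sum from the forest sums at `s` and `s - 1`. At `s = 0` the truncated index
  -- `s - 1` is multiplied by zero.
  induction s using Nat.strong_induction_on with
  | _ s ih =>
    intro r hr
    have hr' : (N : ℝ) = r + s := by exact_mod_cast hr.symm
    have key : sepSum β (initialSeg N r) = hermiteSeq (1 + N * β) β s -
        s * β * hermiteSeq (1 + N * β) β (s - 1) := by
      rcases s with _ | s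
      · obtain rfl : r = N := by omega
        simp [sepSum_initialSeg_self, hermiteSeq]
      · obtain ⟨h1, h2⟩ := ih s (by omega) (r + 1) (by omega)
        rw [sepSum_initialSeg_succ β (by omega), h1, h2 (by omega)]
        rcases s with _ | s
        · simp [hermiteSeq, hr']
          ring
        · simp only [hermiteSeq, Nat.add_sub_cancel]
          rw [hr']; push_cast; ring
    refine ⟨key, fun h => ?_⟩
    obtain ⟨r, rfl⟩ : ∃ k, r = k + 1 := ⟨r - 1, by omega⟩
    have h1 := mul_sepTreeSum_initialSeg (N := N) β (r := r) (by omega)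
    have hpos : ((r : ℝ) + 1) ≠ 0 := by positivity
    refine mul_left_cancel₀ hpos ?_
    rw [h1, key]
    push_cast at hr'
    rcases s with _ | s
    · have : (N : ℝ) - (r + 1) = 0 := by rw [hr']; push_cast; ring
      rw [this, hr']; simp [hermiteSeq]
    · rw [(ih s (by omega) (r + 1 + 1) (by omega)).1]
      rcases s with _ | s
      · simp [hermiteSeq, hr']
        ring
      · simp only [hermiteSeq, Nat.add_sub_cancel]
        rw [hr']; push_cast; ring

lemma sepForests_eq_forests {V : Type*} [Fintype V] {S : Finset V} (h : S.card ≤ 1) :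
    sepForests S = forests (⊤ : SimpleGraph V) := by
  ext F
  rw [mem_sepForests, mem_forests_top, and_iff_left_iff_imp]
  intro _ x hx y hy hxy
  exact absurd (Finset.card_le_one.1 h x hx y hy) hxy

lemma partitionFunction_eq (β : ℝ) : partitionFunction (⊤ : SimpleGraph (Fin N)) β =
    hermiteSeq (1 + N * β) β N - N * β * hermiteSeq (1 + N * β) β (N - 1) := by
  rw [← (sepSum_closed_form β N 0 (by omega)).1, sepSum, sepForests_eq_forests]
  · rfl
  · simp [initialSeg]

end

lemma expect_eq {V : Type*} [Fintype V] (G : SimpleGraph V) (β : ℝ) (f : SimpleGraph V → ℝ) :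
    expect G β f = (∑ F ∈ forests G, weight β F * f F) / partitionFunction G β := by
  rw [expect, Finset.sum_div]
  refine Finset.sum_congr rfl fun F hF => ?_
  rw [pmf, Set.indicator_of_mem (by exact_mod_cast hF), div_mul_eq_mul_div]

lemma card_connectedComponentMk {V : Type*} [Fintype V] (F : SimpleGraph V) (i : V) :
    Nat.card (F.connectedComponentMk i) = (treeVerts F i).card := by
  classical
  refine Nat.subtype_card _ fun u => ?_
  rw [mem_treeVerts, SimpleGraph.reachable_comm, ← SimpleGraph.ConnectedComponent.eq]
  rfl

lemma expectedTreeVertices_eq (β : ℝ) (n : ℕ) :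
    expectedTreeVertices (⊤ : SimpleGraph (Fin (n + 1))) β 0 =
      hermiteSeq (1 + (n + 1 : ℕ) * β) β n / partitionFunction (⊤ : SimpleGraph (Fin (n + 1))) β := by
  rw [expectedTreeVertices, expect_eq]
  congr 1
  rw [← (sepSum_closed_form (N := n + 1) β n 1 (by omega)).2 one_pos, sepTreeSum,
    sepForests_eq_forests (card_initialSeg (by omega)).le]
  exact Finset.sum_congr rfl fun F _ => by rw [card_connectedComponentMk]; rfl

lemma partitionFunction_pos {V : Type*} [Fintype V] (G : SimpleGraph V) {β : ℝ} (hβ : 0 ≤ β) :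
    0 < partitionFunction G β := by
  have h : (⊥ : SimpleGraph V) ∈ forests G := by simp [forests]
  refine Finset.sum_pos' (fun F _ => by unfold weight; positivity) ⟨⊥, h, by simp [weight]⟩

lemma expectedTreeEdges_eq {V : Type*} [Fintype V] (G : SimpleGraph V) {β : ℝ} (hβ : 0 ≤ β) (i : V) :
    expectedTreeEdges G β i = expectedTreeVertices G β i - 1 := by
  have hZ := (partitionFunction_pos G hβ).ne'
  rw [expectedTreeEdges, expectedTreeVertices, expect_eq, expect_eq, eq_sub_iff_add_eq,
    div_add_one hZ]
  congr 1
  rw [partitionFunction, ← Finset.sum_add_distrib]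
  refine Finset.sum_congr rfl fun F hF => ?_
  have hF' : F.IsAcyclic := by
    simp only [forests, Finset.mem_filter] at hF
    exact hF.2.2
  classical
  have h := (hF'.isTree_connectedComponent (F.connectedComponentMk i)).card_edgeFinset
  have : (treeAt F i).edgeSet.ncard + 1 = Nat.card (F.connectedComponentMk i) := by
    rw [Nat.card_eq_fintype_card, ← h, ← SimpleGraph.coe_edgeFinset, Set.ncard_coe_finset]
    rfl
  rw [← this]
  push_cast; ring

/-- By symmetry each of the other `n + 1` vertices lies in the tree of `0` with the same
probability. Algebraically this is the counting identity for a single marked vertex. -/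
lemma connProb_eq {β : ℝ} (hβ : 0 ≤ β) (n : ℕ) :
    connProb (⊤ : SimpleGraph (Fin (n + 2))) β 0 1 =
      (expectedTreeVertices (⊤ : SimpleGraph (Fin (n + 2))) β 0 - 1) / (n + 1) := by
  have hZ := (partitionFunction_pos (⊤ : SimpleGraph (Fin (n + 2))) hβ).ne'
  have hn : (n + 1 : ℝ) ≠ 0 := by positivity
  classical
  have h1 := sepSum_closed_form (N := n + 2) β (n + 1) 1 (by omega)
  have h2 := mul_sepTreeSum_initialSeg (N := n + 2) β (r := 0) (by omega)
  have h3 : sepSum β (initialSeg (n + 2) 1) = partitionFunction (⊤ : SimpleGraph (Fin (n + 2))) β := by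
    rw [sepSum, sepForests_eq_forests (card_initialSeg (by omega)).le]; rfl
  have h4 : partitionFunction (⊤ : SimpleGraph (Fin (n + 2))) β = sepSum β (initialSeg (n + 2) 2) +
      ∑ F ∈ forests (⊤ : SimpleGraph (Fin (n + 2))),
        weight β F * Set.indicator {F | F.Reachable 0 1} 1 F := by
    have : sepForests (initialSeg (n + 2) 2) = (forests ⊤).filter fun F => ¬ F.Reachable 0 1 := by
      ext F
      rw [mem_sepForests, Finset.mem_filter, mem_forests_top]
      refine and_congr_right fun _ => ?_
      have : ((initialSeg (n + 2) 2 : Finset _) : Set (Fin (n + 2))) = {0, 1} := by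
        ext i
        simp only [Finset.mem_coe, mem_initialSeg, Set.mem_insert_iff, Set.mem_singleton_iff,
          Fin.ext_iff, Fin.val_zero, Fin.val_one]
        omega
      rw [this, Set.pairwise_pair]
      simp [SimpleGraph.reachable_comm (u := (1 : Fin (n + 2)))]
    rw [sepSum, this, partitionFunction, Finset.sum_filter, ← Finset.sum_add_distrib]
    refine Finset.sum_congr rfl fun F _ => ?_
    by_cases h : F.Reachable 0 1 <;> simp [h]
  rw [connProb, prob, expect_eq, expectedTreeVertices_eq, ← h1.2 one_pos, div_eq_div_iff hZ hn]
  field_simp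
  simp only [Nat.cast_zero, zero_add, one_mul] at h2
  rw [h2, h3, eq_sub_of_add_eq' h4.symm]
  push_cast; ring

end ArborealGas
end

/-! ### Gaussian moments on vertical lines -/

noncomputable section

namespace ArborealGas

open MeasureTheory Complex
open scoped Real Topology

section GaussianLine

lemma norm_cexp_line (K a m y : ℝ) :
    ‖cexp (K * (a + y * I - m) ^ 2)‖ = Real.exp (K * ((a - m) ^ 2 - y ^ 2)) := by
  rw [Complex.norm_exp]
  congr 1
  simp [pow_two, Complex.mul_re, Complex.mul_im]

/-- From `1 + t ≤ exp t` with t = y²/a². The growth in `y` is bounded by a Gaussian, which the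
factor exp(-Ky²) absorbs uniformly when `n` is of order `K`. -/
lemma norm_line_pow_le {a : ℝ} (ha : 0 < a) (y : ℝ) (n : ℕ) :
    ‖(a + y * I : ℂ)‖ ^ n ≤ a ^ n * Real.exp (n * y ^ 2 / (2 * a ^ 2)) := by
  have h1 : ‖(a + y * I : ℂ)‖ ≤ a * Real.exp (y ^ 2 / (2 * a ^ 2)) := by
    refine le_of_sq_le_sq ?_ (by positivity)
    rw [← Complex.normSq_eq_norm_sq, Complex.normSq_add_mul_I, mul_pow, ← Real.exp_nat_mul]
    have h2 := Real.add_one_le_exp (((2 : ℕ) : ℝ) * (y ^ 2 / (2 * a ^ 2)))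
    calc a ^ 2 + y ^ 2 = a ^ 2 * (((2 : ℕ) : ℝ) * (y ^ 2 / (2 * a ^ 2)) + 1) := by
          push_cast; field_simp; ring
      _ ≤ _ := by gcongr
  calc ‖(a + y * I : ℂ)‖ ^ n ≤ (a * Real.exp (y ^ 2 / (2 * a ^ 2))) ^ n := by gcongr
    _ = _ := by rw [mul_pow, ← Real.exp_nat_mul]; congr 2; ring

lemma continuous_line (K a m : ℝ) (n : ℕ) :
    Continuous fun y : ℝ => (a + y * I : ℂ) ^ n * cexp (K * (a + y * I - m) ^ 2) := by
  fun_prop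

lemma integrable_line {K : ℝ} (hK : 0 < K) (a m : ℝ) (n : ℕ) :
    Integrable fun y : ℝ => (a + y * I : ℂ) ^ n * cexp (K * (a + y * I - m) ^ 2) := by
  have hg : Integrable fun y : ℝ => (n.factorial * Real.exp (|a| + 1 / (2 * K) + K * (a - m) ^ 2)) *
      Real.exp (-(K / 2) * y ^ 2) := (integrable_exp_neg_mul_sq (by positivity)).const_mul _
  refine hg.mono' (continuous_line K a m n).aestronglyMeasurable (ae_of_all _ fun y => ?_)
  rw [norm_mul, norm_cexp_line, norm_pow]
  have h1 : ‖(a + y * I : ℂ)‖ ≤ |a| + |y| := by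
    refine (norm_add_le _ _).trans ?_
    simp
  have h2 : ‖(a + y * I : ℂ)‖ ^ n ≤ n.factorial * Real.exp (|a| + |y|) := by
    have := Real.pow_div_factorial_le_exp (|a| + |y|) (by positivity) n
    rw [div_le_iff₀ (by positivity)] at this
    calc ‖(a + y * I : ℂ)‖ ^ n ≤ (|a| + |y|) ^ n := by gcongr
      _ ≤ _ := by linarith
  calc ‖(a + y * I : ℂ)‖ ^ n * Real.exp (K * ((a - m) ^ 2 - y ^ 2))
      ≤ (n.factorial * Real.exp (|a| + |y|)) * Real.exp (K * ((a - m) ^ 2 - y ^ 2)) := by gcongr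
    _ ≤ _ := by
      rw [mul_assoc, mul_assoc, ← Real.exp_add, ← Real.exp_add]
      refine mul_le_mul_of_nonneg_left (Real.exp_le_exp.2 ?_) (by positivity)
      -- Half of the Gaussian decay is spent on the exponential exp |y|.
      have h3 : |y| ≤ 1 / (2 * K) + K / 2 * y ^ 2 := by
        have h4 : 0 ≤ (K * |y| - 1) ^ 2 / (2 * K) := by positivity
        have h5 : (K * |y| - 1) ^ 2 / (2 * K) = 1 / (2 * K) + K / 2 * y ^ 2 - |y| := by
          rw [← sq_abs y]; field_simp; ring
        linarith
      linarith

lemma hasDerivAt_line (K a m y : ℝ) (n : ℕ) :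
    HasDerivAt (fun y : ℝ => (a + y * I : ℂ) ^ n * cexp (K * (a + y * I - m) ^ 2))
      (I * (n * (a + y * I) ^ (n - 1) + 2 * K * (a + y * I - m) * (a + y * I) ^ n) *
        cexp (K * (a + y * I - m) ^ 2)) y := by
  have h1 : HasDerivAt (fun y : ℝ => (a + y * I : ℂ)) I y := by
    simpa using ((Complex.ofRealCLM.hasDerivAt (x := y)).mul_const I).const_add (a : ℂ)
  have h2 := (h1.pow n).mul (((h1.sub_const (m : ℂ)).pow 2).const_mul (K : ℂ)).cexp
  refine (h2 : HasDerivAt (fun y : ℝ => (a + y * I : ℂ) ^ n * cexp (K * (a + y * I - m) ^ 2))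
    _ y).congr_deriv ?_
  simp only [Pi.pow_apply]
  push_cast
  ring

/-- A vertical line carries the same Gaussian moments as any other. -/
lemma integral_line {K : ℝ} (hK : 0 < K) (a m : ℝ) : ∀ n : ℕ,
    ∫ y : ℝ, (a + y * I : ℂ) ^ n * cexp (K * (a + y * I - m) ^ 2) =
      √(π / K) * hermiteSeq m (1 / (2 * K)) n := by
  -- The integral of the derivative along the line is zero, which is the three-term Hermite
  -- recurrence; `a` does not appear in it, so only the zeroth moment remains to be computed.
  have hrec : ∀ n : ℕ, n * (∫ y : ℝ, (a + y * I : ℂ) ^ (n - 1) * cexp (K * (a + y * I - m) ^ 2)) +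
      2 * K * ((∫ y : ℝ, (a + y * I : ℂ) ^ (n + 1) * cexp (K * (a + y * I - m) ^ 2)) -
        m * ∫ y : ℝ, (a + y * I : ℂ) ^ n * cexp (K * (a + y * I - m) ^ 2)) = 0 := by
    intro n
    have e : ∀ y : ℝ, I * (n * (a + y * I) ^ (n - 1) + 2 * K * (a + y * I - m) * (a + y * I) ^ n) *
        cexp (K * (a + y * I - m) ^ 2) =
        I * (n * ((a + y * I : ℂ) ^ (n - 1) * cexp (K * (a + y * I - m) ^ 2)) +
        2 * K * ((a + y * I : ℂ) ^ (n + 1) * cexp (K * (a + y * I - m) ^ 2) -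
          m * ((a + y * I : ℂ) ^ n * cexp (K * (a + y * I - m) ^ 2)))) := fun y => by ring
    have i1 := (integrable_line hK a m (n - 1)).const_mul (n : ℂ)
    have i2 := (integrable_line hK a m n).const_mul (m : ℂ)
    have i3 : Integrable fun y : ℝ =>
        2 * K * ((a + y * I : ℂ) ^ (n + 1) * cexp (K * (a + y * I - m) ^ 2) -
          m * ((a + y * I : ℂ) ^ n * cexp (K * (a + y * I - m) ^ 2))) :=
      ((integrable_line hK a m (n + 1)).sub i2).const_mul (2 * K : ℂ)
    have h := integral_eq_zero_of_hasDerivAt_of_integrable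
      (fun y => hasDerivAt_line K a m y n)
      (((i1.add i3).const_mul I).congr (ae_of_all _ fun y => (e y).symm))
      (integrable_line hK a m n)
    rw [integral_congr_ae (ae_of_all _ e), integral_const_mul, integral_add i1 i3,
      integral_const_mul, integral_const_mul, integral_sub (integrable_line hK a m (n + 1)) i2,
      integral_const_mul] at h
    exact (mul_eq_zero.1 h).resolve_left I_ne_zero
  have hK' : (K : ℂ) ≠ 0 := by exact_mod_cast hK.ne'
  have h0 : ∫ y : ℝ, (a + y * I : ℂ) ^ 0 * cexp (K * (a + y * I - m) ^ 2) = √(π / K) := by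
    have h := integral_cexp_quadratic (b := -(K : ℂ)) (by simpa using hK) (2 * K * (a - m) * I)
      (K * (a - m) ^ 2)
    have e : ∀ y : ℝ, (a + y * I : ℂ) ^ 0 * cexp (K * (a + y * I - m) ^ 2) =
        cexp (-K * y ^ 2 + 2 * K * (a - m) * I * y + K * (a - m) ^ 2) := by
      intro y
      rw [pow_zero, one_mul]
      congr 1
      linear_combination (K * y ^ 2 : ℂ) * I_sq
    have e2 : (K * (a - m) ^ 2 - (2 * K * (a - m) * I) ^ 2 / (4 * -K) : ℂ) = 0 := by
      field_simp
      linear_combination (4 * K * (a - m) ^ 2 : ℂ) * I_sq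
    rw [integral_congr_ae (ae_of_all _ e), h, e2, Complex.exp_zero, mul_one, neg_neg,
      Real.sqrt_eq_rpow, Complex.ofReal_cpow (by positivity)]
    push_cast; rfl
  intro n
  induction n using Nat.strong_induction_on with
  | _ n ih =>
    rcases n with _ | _ | n
    · rw [h0]; simp [hermiteSeq]
    · have h := hrec 0
      rw [h0] at h
      simp only [CharP.cast_eq_zero, zero_mul, zero_add, mul_eq_zero, OfNat.ofNat_ne_zero, hK',
        or_self, false_or] at h
      simp only [zero_add]
      rw [sub_eq_zero.1 h]; simp [hermiteSeq]; ring
    · have h := hrec (n + 1)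
      rw [Nat.add_sub_cancel, ih n (by omega), ih (n + 1) (by omega)] at h
      simp only [hermiteSeq]
      have hb : (2 * K * ((1 / (2 * K) : ℝ) : ℂ)) = 1 := by push_cast; field_simp
      generalize (1 / (2 * K) : ℝ) = b at h hb ⊢
      have h2K : (2 * K : ℂ) ≠ 0 := by simpa using hK'
      refine mul_left_cancel₀ h2K ?_
      push_cast at h ⊢
      linear_combination h + (n + 1) * (√(π / K) : ℂ) * (hermiteSeq m b n : ℂ) * hb

end GaussianLine

/-! ### Powers near one -/

section LogExpansion

/-- If `n ζ_n ^ p` is constant and `ζ_n → 0`, then only the first `p` terms of the expansion of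
`log (1 + ζ_n)` contribute to `(1 + ζ_n) ^ n`. -/
lemma tendsto_one_add_pow_mul_exp {ζ : ℕ → ℂ} {c : ℂ} {p : ℕ} (hζ : Tendsto ζ atTop (𝓝 0))
    (hc : ∀ᶠ n : ℕ in atTop, n * ζ n ^ p = c) :
    Tendsto (fun n : ℕ => (1 + ζ n) ^ n * cexp (-(n * logTaylor (p + 1) (ζ n)))) atTop (𝓝 1) := by
  have h1 : Tendsto (fun n : ℕ => n * (log (1 + ζ n) - logTaylor (p + 1) (ζ n))) atTop (𝓝 0) := by
    -- For `‖ζ‖ < 1/2` the Taylor remainder is at most 2‖ζ‖^(p+1), and n‖ζ‖^p = ‖c‖.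
    have h2 : Tendsto (fun n : ℕ => ‖c‖ * (‖ζ n‖ * 2)) atTop (𝓝 0) := by
      simpa using (hζ.norm.mul_const 2).const_mul ‖c‖
    refine squeeze_zero_norm' ?_ h2
    have h3 : ∀ᶠ n in atTop, ‖ζ n‖ < 1 / 2 := by
      have := hζ.norm
      rw [norm_zero] at this
      exact this.eventually_lt_const (by norm_num)
    filter_upwards [hc, h3] with n hn hn'
    have h4 := norm_log_sub_logTaylor_le p (z := ζ n) (by linarith)
    have h5 : (1 - ‖ζ n‖)⁻¹ ≤ 2 := by
      rw [inv_le_comm₀ (by linarith) (by norm_num)]; linarith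
    rw [norm_mul, ← hn, norm_mul, norm_pow, mul_assoc]
    gcongr
    refine h4.trans ((div_le_self (by have := norm_nonneg (ζ n); have : 0 < 1 - ‖ζ n‖ := by linarith
                                      positivity) (by simp)).trans ?_)
    rw [pow_succ, mul_assoc]
    gcongr
  have h6 := (Complex.continuous_exp.tendsto 0).comp h1
  rw [Complex.exp_zero] at h6
  refine h6.congr' ?_
  have h3 : ∀ᶠ n in atTop, ‖ζ n‖ < 1 := by
    have := hζ.norm
    rw [norm_zero] at this
    exact this.eventually_lt_const (by norm_num)
  filter_upwards [h3] with n hn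
  have hne : 1 + ζ n ≠ 0 := by
    intro h
    have : ζ n = -1 := by linear_combination h
    rw [this] at hn; simp at hn
  rw [Function.comp_apply, mul_sub, sub_eq_add_neg, Complex.exp_add, Complex.exp_nat_mul,
    Complex.exp_log hne]

end LogExpansion

end ArborealGas
end

/-! ### Laplace's method at simple and degenerate saddles -/

noncomputable section

namespace ArborealGas

open MeasureTheory Complex
open scoped Real Topology

section Laplace

lemma logTaylor_three (z : ℂ) : logTaylor 3 z = z - z ^ 2 / 2 := by
  simp [logTaylor_succ, logTaylor_zero]; ring

lemma logTaylor_four (z : ℂ) : logTaylor 4 z = z - z ^ 2 / 2 + z ^ 3 / 3 := by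
  simp [logTaylor_succ, logTaylor_zero]; ring

/-- Laplace's method on a vertical line through a nondegenerate saddle point `a` of
`log w + (w - m) ^ 2 / (2 α)`. -/
lemma tendsto_integral_line {α a m C : ℝ} (hα : 0 < α) (ha : 0 < a) (haα : α < a ^ 2)
    (ham : a * (m - a) = α) {H : ℂ → ℂ} (hcont : Continuous fun y : ℝ => H (a + y * I))
    (hC : ∀ y : ℝ, ‖H (a + y * I)‖ ≤ C) :
    Tendsto (fun N : ℕ => (√N : ℂ) * ∫ y : ℝ, (a + y * I : ℂ) ^ N *
      cexp (((N / (2 * α) : ℝ) : ℂ) * (a + y * I - m) ^ 2) * H (a + y * I) /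
        ((a ^ N * Real.exp (N / (2 * α) * (a - m) ^ 2) : ℝ) : ℂ)) atTop
      (𝓝 (H a * (√(2 * π / (1 / α - 1 / a ^ 2)) : ℝ))) := by
  set κ : ℝ := 1 / α - 1 / a ^ 2 with hκ
  have hκ0 : 0 < κ := sub_pos.2 (one_div_lt_one_div_of_lt hα haα)
  have haC : (a : ℂ) ≠ 0 := by exact_mod_cast ha.ne'
  have hαC : (α : ℂ) ≠ 0 := by exact_mod_cast hα.ne'
  have hlim : H a * (√(2 * π / κ) : ℝ) = ∫ u : ℝ, (Real.exp (-(κ / 2) * u ^ 2) : ℂ) * H a := by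
    rw [integral_mul_const, integral_complex_ofReal, integral_gaussian, mul_comm]
    congr 3
    field_simp
  rw [hlim]
  set Φ : ℕ → ℝ → ℂ := fun N y => (a + y * I : ℂ) ^ N *
      cexp (((N / (2 * α) : ℝ) : ℂ) * (a + y * I - m) ^ 2) * H (a + y * I) /
        ((a ^ N * Real.exp (N / (2 * α) * (a - m) ^ 2) : ℝ) : ℂ) with hΦ
  have hΦc : ∀ N, Continuous (Φ N) := fun N =>
    (((continuous_line _ a m N)).mul hcont).div_const _
  -- Rescaling y = u/√N. The bounds of `norm_line_pow_le` and `norm_cexp_line` combine to exactly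
  -- exp(-κu²/2), so the limiting Gaussian also dominates for every `N > 0`.
  have hmain : Tendsto (fun N : ℕ => ∫ u : ℝ, Φ N (u / √N)) atTop
      (𝓝 (∫ u : ℝ, (Real.exp (-(κ / 2) * u ^ 2) : ℂ) * H a)) := by
    refine tendsto_integral_filter_of_dominated_convergence
      (fun u => C * Real.exp (-(κ / 2) * u ^ 2))
      (Eventually.of_forall fun N => ((hΦc N).comp (by fun_prop)).aestronglyMeasurable) ?_
      ((integrable_exp_neg_mul_sq (by positivity)).const_mul _) (ae_of_all _ fun u => ?_)
    · filter_upwards [eventually_gt_atTop 0] with N hN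
      refine ae_of_all _ fun u => ?_
      have hNpos : (0 : ℝ) < N := by exact_mod_cast hN
      have hden : 0 < a ^ N * Real.exp (N / (2 * α) * (a - m) ^ 2) := by positivity
      have hu : (N : ℝ) * (u / √N) ^ 2 = u ^ 2 := by
        rw [div_pow, Real.sq_sqrt hNpos.le]; field_simp
      rw [hΦ]
      dsimp only
      rw [norm_div, norm_mul, norm_mul, norm_pow, norm_cexp_line, Complex.norm_real,
        Real.norm_of_nonneg hden.le, div_le_iff₀ hden]
      calc _ ≤ a ^ N * Real.exp (N * (u / √N) ^ 2 / (2 * a ^ 2)) *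
            Real.exp (N / (2 * α) * ((a - m) ^ 2 - (u / √N) ^ 2)) * C := by
            gcongr
            · exact norm_line_pow_le ha _ _
            · exact hC _
        _ = C * Real.exp (-(κ / 2) * u ^ 2) * (a ^ N * Real.exp (N / (2 * α) * (a - m) ^ 2)) := by
            have e : Real.exp (N * (u / √N) ^ 2 / (2 * a ^ 2)) *
                Real.exp (N / (2 * α) * ((a - m) ^ 2 - (u / √N) ^ 2)) =
                Real.exp (-(κ / 2) * u ^ 2) * Real.exp (N / (2 * α) * (a - m) ^ 2) := by
              rw [← Real.exp_add, ← Real.exp_add]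
              congr 1
              rw [← hu, hκ]
              field_simp
              ring
            linear_combination a ^ N * C * e
    · have hsq : Tendsto (fun N : ℕ => u / √(N : ℝ)) atTop (𝓝 0) :=
        tendsto_const_nhds.div_atTop (Real.tendsto_sqrt_atTop.comp tendsto_natCast_atTop_atTop)
      have hHlim : Tendsto (fun N : ℕ => H (a + ((u / √(N : ℝ) : ℝ) : ℂ) * I)) atTop (𝓝 (H a)) := by
        have := (hcont.tendsto 0).comp hsq
        simpa [Function.comp_def] using this
      have hζ0 : Tendsto (fun N : ℕ => ((u / √(N : ℝ) : ℝ) : ℂ) * I / a) atTop (𝓝 0) := by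
        have := ((Complex.continuous_ofReal.tendsto 0).comp hsq).mul_const (I / a)
        simpa [mul_div_assoc] using this
      have hu : ∀ N : ℕ, 0 < N → (N : ℂ) * ((u / √(N : ℝ) : ℝ) : ℂ) ^ 2 = u ^ 2 := by
        intro N hN
        have hNpos : (0 : ℝ) < N := by exact_mod_cast hN
        have : (N : ℝ) * (u / √N) ^ 2 = u ^ 2 := by
          rw [div_pow, Real.sq_sqrt hNpos.le]; field_simp
        exact_mod_cast this
      have hlog := tendsto_one_add_pow_mul_exp (p := 2) (c := -u ^ 2 / a ^ 2) hζ0 (by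
        filter_upwards [eventually_gt_atTop 0] with N hN
        rw [div_pow, mul_pow, I_sq, ← hu N hN]
        ring)
      have hfin := (hlog.mul_const (Real.exp (-(κ / 2) * u ^ 2) : ℂ)).mul hHlim
      rw [one_mul] at hfin
      refine hfin.congr' ?_
      filter_upwards [eventually_gt_atTop 0] with N hN
      rw [hΦ]
      dsimp only
      rw [logTaylor_three]
      set y : ℂ := ((u / √(N : ℝ) : ℝ) : ℂ) with hy
      have haN : (a : ℂ) ^ N ≠ 0 := pow_ne_zero _ haC
      have e1 : (a + y * I : ℂ) ^ N = a ^ N * (1 + y * I / a) ^ N := by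
        rw [← mul_pow]; congr 1; field_simp
      have e2 : cexp (((N / (2 * α) : ℝ) : ℂ) * (a + y * I - m) ^ 2) =
          cexp (-(N * (y * I / a - (y * I / a) ^ 2 / 2))) * (Real.exp (-(κ / 2) * u ^ 2) : ℂ) *
            (Real.exp (N / (2 * α) * (a - m) ^ 2) : ℂ) := by
        push_cast
        rw [← Complex.exp_add, ← Complex.exp_add]
        congr 1
        rw [← hu N hN, ← hy, hκ]
        push_cast
        -- The saddle equation; it cancels the terms linear in `y`.
        have hm : (m : ℂ) = a + α / a := by
          rw [← ham]; push_cast; field_simp; ring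
        rw [hm]
        field_simp
        have := I_sq
        ring_nf
        simp only [I_sq]
        ring
      rw [e1, e2]
      push_cast
      have hexp : cexp (N / (2 * α) * (a - m) ^ 2) ≠ 0 := Complex.exp_ne_zero _
      field_simp
  refine hmain.congr' ?_
  filter_upwards [eventually_gt_atTop 0] with N hN
  rw [Measure.integral_comp_div (Φ N) (√N), abs_of_nonneg (Real.sqrt_nonneg _)]
  exact Complex.real_smul

/-- The difference of the two sides has derivative t³/(1 + t) ≥ 0 and vanishes at zero. -/
lemma log_one_add_le {x : ℝ} (hx : 0 ≤ x) : Real.log (1 + x) ≤ x - x ^ 2 / 2 + x ^ 3 / 3 := by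
  have hd : ∀ t : ℝ, 0 ≤ t → HasDerivAt (fun t : ℝ => t - t ^ 2 / 2 + t ^ 3 / 3 - Real.log (1 + t))
      (t ^ 3 / (1 + t)) t := by
    intro t ht
    have h1 := ((((hasDerivAt_id t).sub (((hasDerivAt_id t).pow 2).div_const 2)).add
      (((hasDerivAt_id t).pow 3).div_const 3)).sub
      (((hasDerivAt_id t).const_add 1).log (by simp only [id]; positivity)))
    refine h1.congr_deriv ?_
    have : (1 + t) ≠ 0 := by positivity
    simp only [id]
    field_simp
    push_cast
    ring
  have hm : MonotoneOn (fun t : ℝ => t - t ^ 2 / 2 + t ^ 3 / 3 - Real.log (1 + t)) (Set.Ici 0) := by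
    refine monotoneOn_of_hasDerivWithinAt_nonneg (convex_Ici 0)
      (fun t ht => (hd t ht).continuousAt.continuousWithinAt)
      (fun t ht => (hd t (interior_subset ht)).hasDerivWithinAt) fun t ht => ?_
    have : 0 ≤ t := interior_subset ht
    positivity
  have := hm (Set.mem_Ici.2 le_rfl) (Set.mem_Ici.2 hx) hx
  simp at this
  linarith

/-- The majorant at criticality. At `u = 0` the linear and quadratic terms add up to N/2, and the
cubic term Nδ³/3 gives the constant exp(1/3). The `u`-dependence is -u²(2 + δ)/(2(1 + δ)²), below
-u²/4 because δ² ≤ 3. -/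
lemma norm_critical_le {δ u : ℝ} (hδ : 0 < δ) (hδ1 : δ ≤ 1) {N : ℕ} (hN : N * δ ^ 3 = 1) :
    ‖(((1 + δ : ℝ) : ℂ) + ((δ * u : ℝ) : ℂ) * I) ^ N *
      cexp (((N / 2 : ℝ) : ℂ) * (((1 + δ : ℝ) : ℂ) + ((δ * u : ℝ) : ℂ) * I - (2 : ℝ)) ^ 2)‖ ≤
      Real.exp (1 / 3) * Real.exp (-(1 / 4) * u ^ 2) * Real.exp (N / 2) := by
  rw [norm_mul, norm_cexp_line, norm_pow]
  have h1 := log_one_add_le hδ.le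
  have h2 : (1 + δ) ^ N = Real.exp (N * Real.log (1 + δ)) := by
    rw [Real.exp_nat_mul, Real.exp_log (by positivity)]
  calc _ ≤ (1 + δ) ^ N * Real.exp (N * (δ * u) ^ 2 / (2 * (1 + δ) ^ 2)) *
        Real.exp (N / 2 * ((1 + δ - 2) ^ 2 - (δ * u) ^ 2)) := by
        gcongr
        exact norm_line_pow_le (by positivity) _ _
    _ ≤ _ := by
      rw [h2, ← Real.exp_add, ← Real.exp_add, ← Real.exp_add, ← Real.exp_add, Real.exp_le_exp]
      have h3 : N * Real.log (1 + δ) ≤ N * (δ - δ ^ 2 / 2 + δ ^ 3 / 3) := by gcongr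
      have hN0 : (N : ℝ) = 1 / δ ^ 3 := by field_simp; exact hN
      have h4 : N * (δ * u) ^ 2 / (2 * (1 + δ) ^ 2) - N / 2 * (δ * u) ^ 2 ≤ -(1 / 4) * u ^ 2 := by
        have : N * (δ * u) ^ 2 / (2 * (1 + δ) ^ 2) - N / 2 * (δ * u) ^ 2 - -(1 / 4) * u ^ 2 =
            -(u ^ 2 * (3 - δ ^ 2) / (4 * (1 + δ) ^ 2)) := by
          rw [hN0]; field_simp; ring
        have h5 : 0 ≤ u ^ 2 * (3 - δ ^ 2) / (4 * (1 + δ) ^ 2) := by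
          have : 0 ≤ 3 - δ ^ 2 := by nlinarith
          positivity
        linarith
      nlinarith

/-- Laplace's method at the degenerate saddle point `1` of `log w + (w - 2) ^ 2 / 2`. -/
lemma tendsto_integral_line_critical (k : ℕ) :
    Tendsto (fun N : ℕ => (((N : ℝ) ^ (1 / 3 : ℝ) : ℝ) : ℂ) * ∫ y : ℝ,
      (((1 + (N : ℝ) ^ (-1 / 3 : ℝ) : ℝ) : ℂ) + y * I) ^ N *
      cexp (((N / 2 : ℝ) : ℂ) * (((1 + (N : ℝ) ^ (-1 / 3 : ℝ) : ℝ) : ℂ) + y * I - (2 : ℝ)) ^ 2) *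
      ((1 + (((N : ℝ) ^ (1 / 3 : ℝ) * y : ℝ) : ℂ) * I) ^ k /
        (((1 + (N : ℝ) ^ (-1 / 3 : ℝ) : ℝ) : ℂ) + y * I)) / (Real.exp (N / 2) : ℝ)) atTop
      (𝓝 (∫ u : ℝ, (1 + u * I) ^ k * cexp ((1 + u * I) ^ 3 / 3))) := by
  -- The line passes at distance N^{-1/3} to the right of the saddle, so that w - 1 = δ(1 + iu)
  -- after scaling; on the line through the saddle itself the cubic term would give no decay.
  set δ : ℕ → ℝ := fun N => (N : ℝ) ^ (-1 / 3 : ℝ) with hδ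
  have hδpos : ∀ N : ℕ, 0 < N → 0 < δ N := fun N hN =>
    Real.rpow_pos_of_pos (by exact_mod_cast hN) _
  have hδinv : ∀ N : ℕ, 0 < N → (N : ℝ) ^ (1 / 3 : ℝ) = (δ N)⁻¹ := fun N hN => by
    rw [hδ]
    dsimp only
    rw [← Real.rpow_neg (by positivity)]; norm_num
  have hδ3 : ∀ N : ℕ, 0 < N → N * δ N ^ 3 = 1 := fun N hN => by
    have hN' : (0 : ℝ) < N := by exact_mod_cast hN
    rw [hδ]
    dsimp only
    rw [← Real.rpow_natCast, ← Real.rpow_mul hN'.le]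
    norm_num
    rw [Real.rpow_neg_one]
    field_simp
  have hδ1 : ∀ N : ℕ, 0 < N → δ N ≤ 1 := fun N hN =>
    Real.rpow_le_one_of_one_le_of_nonpos (by exact_mod_cast hN) (by norm_num)
  have hδ0 : Tendsto δ atTop (𝓝 0) := by
    have := (tendsto_rpow_neg_atTop (y := 1 / 3) (by norm_num)).comp tendsto_natCast_atTop_atTop
    refine this.congr fun N => ?_
    rw [hδ]
    norm_num
  set Φ : ℕ → ℝ → ℂ := fun N y => (((1 + δ N : ℝ) : ℂ) + y * I) ^ N *
      cexp (((N / 2 : ℝ) : ℂ) * (((1 + δ N : ℝ) : ℂ) + y * I - (2 : ℝ)) ^ 2) *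
      ((1 + (((N : ℝ) ^ (1 / 3 : ℝ) * y : ℝ) : ℂ) * I) ^ k /
        (((1 + δ N : ℝ) : ℂ) + y * I)) / (Real.exp (N / 2) : ℝ) with hΦ
  have hline : ∀ (N : ℕ) (y : ℝ), 1 ≤ ‖((1 + δ N : ℝ) : ℂ) + y * I‖ := by
    intro N y
    have h1 := Complex.re_le_norm (((1 + δ N : ℝ) : ℂ) + y * I)
    have h2 : 0 ≤ δ N := Real.rpow_nonneg (by positivity) _
    simp only [Complex.add_re, Complex.ofReal_re, Complex.mul_re, Complex.I_re, mul_zero,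
      Complex.ofReal_im, Complex.I_im, mul_one, sub_self, add_zero] at h1
    linarith
  have hline0 : ∀ (N : ℕ) (y : ℝ), ((1 + δ N : ℝ) : ℂ) + y * I ≠ 0 := fun N y h => by
    have := hline N y
    rw [h, norm_zero] at this
    linarith
  have hΦc : ∀ N, Continuous (Φ N) := fun N =>
    (((continuous_line _ _ _ N)).mul (Continuous.div (by fun_prop) (by fun_prop)
      (hline0 N))).div_const _
  have hdom : Integrable fun u : ℝ => Real.exp (1 / 3) *
      ‖(((1 : ℝ) : ℂ) + u * I) ^ k * cexp (((1 / 4 : ℝ) : ℂ) * (((1 : ℝ) : ℂ) + u * I - (1 : ℝ)) ^ 2)‖ :=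
    ((integrable_line (by norm_num) 1 1 k).norm).const_mul _
  have hmain : Tendsto (fun N : ℕ => ∫ u : ℝ, Φ N (δ N * u)) atTop
      (𝓝 (∫ u : ℝ, (1 + u * I) ^ k * cexp ((1 + u * I) ^ 3 / 3))) := by
    refine tendsto_integral_filter_of_dominated_convergence _
      (Eventually.of_forall fun N => ((hΦc N).comp (by fun_prop)).aestronglyMeasurable) ?_
      hdom (ae_of_all _ fun u => ?_)
    · filter_upwards [eventually_gt_atTop 0] with N hN
      refine ae_of_all _ fun u => ?_
      have h1 := norm_critical_le (u := u) (hδpos N hN) (hδ1 N hN) (hδ3 N hN)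
      have h2 := hline N (δ N * u)
      have h3 := (hδpos N hN).ne'
      rw [norm_mul _ (cexp _), norm_cexp_line, hΦ]
      dsimp only
      rw [norm_div, norm_mul, Complex.norm_real, Real.norm_of_nonneg (Real.exp_pos _).le,
        div_le_iff₀ (Real.exp_pos _), norm_div]
      have e1 : (N : ℝ) ^ (1 / 3 : ℝ) * (δ N * u) = u := by
        rw [hδinv N hN]; field_simp
      rw [e1]
      calc _ ≤ (Real.exp (1 / 3) * Real.exp (-(1 / 4) * u ^ 2) * Real.exp (N / 2)) *
            (‖(1 + u * I : ℂ) ^ k‖ / 1) := by gcongr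
        _ = _ := by
          have e2 : (1 / 4 * ((1 - 1) ^ 2 - u ^ 2) : ℝ) = -(1 / 4) * u ^ 2 := by ring
          rw [e2, Complex.ofReal_one]
          ring
    · have hζ0 : Tendsto (fun N : ℕ => (δ N : ℂ) * (1 + u * I)) atTop (𝓝 0) := by
        have := ((Complex.continuous_ofReal.tendsto 0).comp hδ0).mul_const (1 + u * I : ℂ)
        simpa using this
      have hδ3' : ∀ N : ℕ, 0 < N → (N : ℂ) * (δ N : ℂ) ^ 3 = 1 := fun N hN => by
        exact_mod_cast hδ3 N hN
      have hlog := tendsto_one_add_pow_mul_exp (p := 3) (c := (1 + u * I) ^ 3) hζ0 (by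
        filter_upwards [eventually_gt_atTop 0] with N hN
        rw [mul_pow, ← mul_assoc, hδ3' N hN, one_mul])
      have hw : Tendsto (fun N : ℕ => (1 + u * I : ℂ) ^ k / (1 + (δ N : ℂ) * (1 + u * I))) atTop
          (𝓝 ((1 + u * I : ℂ) ^ k)) := by
        have := (tendsto_const_nhds (x := (1 + u * I : ℂ) ^ k)).div (hζ0.const_add 1) (by simp)
        simpa [Pi.div_def] using this
      have hfin := (hlog.mul_const (cexp ((1 + u * I) ^ 3 / 3))).mul hw
      rw [one_mul, mul_comm (cexp _)] at hfin
      refine hfin.congr' ?_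
      filter_upwards [eventually_gt_atTop 0] with N hN
      have e1 : (N : ℝ) ^ (1 / 3 : ℝ) * (δ N * u) = u := by
        have := (hδpos N hN).ne'
        rw [hδinv N hN]; field_simp
      rw [hΦ]
      dsimp only
      rw [logTaylor_four, e1]
      have e2 : (((1 + δ N : ℝ) : ℂ) + ((δ N * u : ℝ) : ℂ) * I) = 1 + δ N * (1 + u * I) := by
        push_cast; ring
      rw [e2]
      -- With z = δ(1 + iu): z - z²/2 + z³/3 + (z - 1)²/2 = 1/2 + z³/3, and Nz³ = (1 + iu)³.
      have e3 : cexp (((N / 2 : ℝ) : ℂ) * (1 + δ N * (1 + u * I) - (2 : ℝ)) ^ 2) =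
          cexp (-(N * (δ N * (1 + u * I) - (δ N * (1 + u * I)) ^ 2 / 2 +
            (δ N * (1 + u * I)) ^ 3 / 3))) * cexp ((1 + u * I) ^ 3 / 3) * (Real.exp (N / 2) : ℝ) := by
        push_cast
        rw [← Complex.exp_add, ← Complex.exp_add]
        congr 1
        linear_combination ((1 + u * I) ^ 3 / 3 : ℂ) * hδ3' N hN
      rw [e3]
      have hexp : ((Real.exp (N / 2) : ℝ) : ℂ) ≠ 0 := by exact_mod_cast (Real.exp_pos _).ne'
      field_simp
  refine hmain.congr' ?_
  filter_upwards [eventually_gt_atTop 0] with N hN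
  rw [Measure.integral_comp_mul_left (Φ N) (δ N), abs_of_nonneg (inv_pos.2 (hδpos N hN)).le,
    hδinv N hN]
  rw [hΦ, Complex.real_smul]
  simp only [hδinv N hN]
  rfl

end Laplace
end ArborealGas
end

/-! ### The Airy-type integrals by rotation of the contour -/

noncomputable section

namespace ArborealGas

open MeasureTheory Complex
open scoped Real Topology

section Airy

/-- The sixth root of unity `exp (i π / 3)`. -/
def sixthRoot : ℂ := 1 / 2 + (√3 / 2 : ℝ) * I

lemma sqrt_three_sq : (√3 : ℝ) ^ 2 = 3 := Real.sq_sqrt (by norm_num)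

lemma sixthRoot_sq : sixthRoot ^ 2 = -(1 / 2) + (√3 / 2 : ℝ) * I := by
  have h : ((√3 : ℝ) : ℂ) ^ 2 = 3 := by exact_mod_cast sqrt_three_sq
  rw [sixthRoot]
  push_cast
  linear_combination (1 / 4 * I ^ 2 : ℂ) * h + (3 / 4 : ℂ) * I_sq

lemma sixthRoot_cube : sixthRoot ^ 3 = -1 := by
  have h : ((√3 : ℝ) : ℂ) ^ 2 = 3 := by exact_mod_cast sqrt_three_sq
  rw [pow_succ, sixthRoot_sq, sixthRoot]
  push_cast
  linear_combination (1 / 4 * I ^ 2 : ℂ) * h + (3 / 4 : ℂ) * I_sq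

lemma norm_sixthRoot : ‖sixthRoot‖ = 1 := by
  have h : ‖sixthRoot‖ ^ 3 = 1 := by rw [← norm_pow, sixthRoot_cube]; simp
  exact (pow_eq_one_iff_of_nonneg (norm_nonneg _) (by norm_num)).1 h

/-- A direction between `i` and `exp (i π / 3)`. -/
def rayDir (τ : ℝ) : ℂ := (1 - τ) * I + τ * sixthRoot

/-- A homotopy between the half line `1 + i u` and the ray `u exp (i π / 3)`. -/
def rayPoint (τ u : ℝ) : ℂ := (1 - τ) + u * rayDir τ

lemma rayDir_re (τ : ℝ) : (rayDir τ).re = τ / 2 := by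
  simp [rayDir, sixthRoot]; ring

lemma rayDir_im (τ : ℝ) : (rayDir τ).im = 1 - τ + τ * (√3 / 2) := by
  simp [rayDir, sixthRoot]

lemma norm_rayDir_le {τ : ℝ} (h0 : 0 ≤ τ) (h1 : τ ≤ 1) : ‖rayDir τ‖ ≤ 1 := by
  refine (norm_add_le _ _).trans ?_
  rw [norm_mul, norm_mul, norm_sixthRoot, norm_I, ← Complex.ofReal_one, ← Complex.ofReal_sub,
    Complex.norm_real, Complex.norm_real, Real.norm_of_nonneg h0,
    Real.norm_of_nonneg (sub_nonneg.2 h1)]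
  linarith

lemma norm_rayPoint_le {τ u : ℝ} (h0 : 0 ≤ τ) (h1 : τ ≤ 1) (hu : 0 ≤ u) :
    ‖rayPoint τ u‖ ≤ 1 + u := by
  refine (norm_add_le _ _).trans ?_
  rw [norm_mul, ← Complex.ofReal_one, ← Complex.ofReal_sub, Complex.norm_real, Complex.norm_real,
    Real.norm_of_nonneg hu, Real.norm_of_nonneg (sub_nonneg.2 h1)]
  have := norm_rayDir_le h0 h1
  nlinarith

/-- A bound uniform in `τ`, hence only quadratic: at `τ = 0` the real part is 1/3 - u². For `u ≤ 2`
it is at most 4/3 = 2 - 4/6, and for `u ≥ 2` at most -u²/6. -/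
lemma rayPoint_cube_re_le {τ u : ℝ} (h0 : 0 ≤ τ) (h1 : τ ≤ 1) (hu : 0 ≤ u) :
    (rayPoint τ u ^ 3 / 3).re ≤ 2 - u ^ 2 / 6 := by
  set p : ℝ := (1 - τ) + u * (τ / 2) with hp
  set y : ℝ := 1 - τ + τ * (√3 / 2) with hy
  have hpt : rayPoint τ u = p + (u * y : ℝ) * I := by
    apply Complex.ext <;> simp [rayPoint, rayDir_re, rayDir_im, hp, hy]
  have hre : (rayPoint τ u ^ 3 / 3).re = p * (p ^ 2 - 3 * u ^ 2 * y ^ 2) / 3 := by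
    have : rayPoint τ u ^ 3 / 3 = ((p * (p ^ 2 - 3 * u ^ 2 * y ^ 2) / 3 : ℝ) : ℂ) +
        ((3 * p ^ 2 * (u * y) - (u * y) ^ 3) / 3 : ℝ) * I := by
      rw [hpt]; push_cast
      linear_combination (p * (u * y) ^ 2 + (u * y) ^ 3 * I / 3 : ℂ) * I_sq
    rw [this, Complex.add_re, Complex.ofReal_re, Complex.re_ofReal_mul, Complex.I_re, mul_zero,
      add_zero]
  have hs : 0 ≤ √3 := Real.sqrt_nonneg _
  have hs2 : √3 ≤ 2 := by nlinarith [sqrt_three_sq]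
  have hy2 : 3 / 4 ≤ y ^ 2 := by
    have h3 : √3 / 2 ≤ y := by rw [hy]; nlinarith
    calc (3 / 4 : ℝ) = (√3 / 2) ^ 2 := by rw [div_pow, sqrt_three_sq]; norm_num
      _ ≤ y ^ 2 := by gcongr
  have hp0 : 0 ≤ p := by
    have : 0 ≤ u * (τ / 2) := by positivity
    rw [hp]; linarith
  have hq : p ^ 2 - 3 * u ^ 2 * y ^ 2 ≤ 1 + u - 2 * u ^ 2 := by
    have h3 : p ≤ 1 + u / 2 := by rw [hp]; nlinarith
    have h4 : p ^ 2 ≤ (1 + u / 2) ^ 2 := by gcongr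
    have h5 : 3 * u ^ 2 * (3 / 4) ≤ 3 * u ^ 2 * y ^ 2 := by gcongr
    nlinarith
  have hpq : p * (p ^ 2 - 3 * u ^ 2 * y ^ 2) ≤ p * (1 + u - 2 * u ^ 2) := by gcongr
  rw [hre]
  rcases le_total u 2 with h | h
  · have h3 : p ≤ 1 + u / 2 := by rw [hp]; nlinarith
    have h4 : p * (1 + u - 2 * u ^ 2) ≤ 4 := by
      rcases le_total (1 + u - 2 * u ^ 2) 0 with h5 | h5
      · nlinarith [mul_nonneg hp0 (neg_nonneg.2 h5)]
      · have : 1 + u - 2 * u ^ 2 ≤ 2 := by nlinarith [sq_nonneg (u - 1 / 4)]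
        exact (mul_le_mul (h3.trans (by linarith : _ ≤ (2 : ℝ))) this h5 zero_le_two).trans (by norm_num)
    have h5 : u ^ 2 ≤ 4 := by nlinarith
    linarith
  · have h3 : 1 / 2 ≤ p := by rw [hp]; nlinarith
    have h4 : 1 + u - 2 * u ^ 2 ≤ -u ^ 2 := by nlinarith
    have h5 : p * (1 + u - 2 * u ^ 2) ≤ p * -u ^ 2 := by gcongr
    have h6 : 1 / 2 * u ^ 2 ≤ p * u ^ 2 := by gcongr
    have h7 : p * -u ^ 2 = -(p * u ^ 2) := by ring
    linarith

lemma norm_cexp_rayPoint_le {τ u : ℝ} (h0 : 0 ≤ τ) (h1 : τ ≤ 1) (hu : 0 ≤ u) :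
    ‖cexp (rayPoint τ u ^ 3 / 3)‖ ≤ Real.exp (2 - u ^ 2 / 6) := by
  rw [Complex.norm_exp, Real.exp_le_exp]
  exact rayPoint_cube_re_le h0 h1 hu

lemma integrable_one_add_pow_mul_exp (n : ℕ) :
    IntegrableOn (fun u : ℝ => (1 + u) ^ n * Real.exp (2 - u ^ 2 / 6)) (Set.Ioi 0) := by
  have h := ((integrable_line (K := 1 / 6) (by norm_num) 1 1 n).norm.const_mul
    (2 ^ n * Real.exp 2)).integrableOn (s := Set.Ioi 0)
  refine Integrable.mono' h (by fun_prop) ?_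
  refine (ae_restrict_mem measurableSet_Ioi).mono fun u hu => ?_
  have hu : 0 < u := hu
  rw [Real.norm_of_nonneg (by positivity), norm_mul, norm_cexp_line, norm_pow]
  have h1 : 1 + u ≤ 2 * ‖(((1 : ℝ) : ℂ) + u * I)‖ := by
    refine le_of_sq_le_sq ?_ (by positivity)
    rw [mul_pow, ← Complex.normSq_eq_norm_sq, Complex.normSq_add_mul_I]
    nlinarith [sq_nonneg (1 - u)]
  calc (1 + u) ^ n * Real.exp (2 - u ^ 2 / 6)
      ≤ (2 * ‖(((1 : ℝ) : ℂ) + u * I)‖) ^ n * Real.exp (2 - u ^ 2 / 6) := by gcongr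
    _ = _ := by
      have : Real.exp (2 - u ^ 2 / 6) = Real.exp 2 * Real.exp (1 / 6 * ((1 - 1) ^ 2 - u ^ 2)) := by
        rw [← Real.exp_add]; congr 1; ring
      rw [this, mul_pow]; ring

lemma hasDerivAt_rayPoint_left (τ u : ℝ) :
    HasDerivAt (fun τ : ℝ => rayPoint τ u) (-1 + u * (sixthRoot - I)) τ := by
  have h := Complex.ofRealCLM.hasDerivAt (x := τ)
  have h1 := (h.const_sub 1).add ((((h.const_sub 1).mul_const I).add (h.mul_const sixthRoot)).const_mul
    (u : ℂ))
  refine h1.congr_deriv ?_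
  simp only [Complex.ofRealCLM_apply, Complex.ofReal_one]
  ring

lemma hasDerivAt_rayPoint_right (τ u : ℝ) :
    HasDerivAt (fun u : ℝ => rayPoint τ u) (rayDir τ) u := by
  have h := Complex.ofRealCLM.hasDerivAt (x := u)
  have h1 := (h.mul_const (rayDir τ)).const_add (1 - τ : ℂ)
  refine h1.congr_deriv ?_
  simp

lemma hasDerivAt_rayDir (τ : ℝ) : HasDerivAt rayDir (sixthRoot - I) τ := by
  have h := Complex.ofRealCLM.hasDerivAt (x := τ)
  have h1 := ((h.const_sub 1).mul_const I).add (h.mul_const sixthRoot)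
  refine h1.congr_deriv ?_
  simp; ring

lemma hasDerivAt_pow_mul_cexp (k : ℕ) (s : ℂ) :
    HasDerivAt (fun s : ℂ => s ^ k * cexp (s ^ 3 / 3))
      ((k * s ^ (k - 1) + s ^ (k + 2)) * cexp (s ^ 3 / 3)) s := by
  have h := (hasDerivAt_pow k s).mul ((hasDerivAt_pow 3 s).div_const 3).cexp
  refine h.congr_deriv ?_
  push_cast
  ring

/-- The common derivative of the integrand with respect to the homotopy parameter, and of the
boundary term along the path. -/
def rayDeriv (k : ℕ) (τ u : ℝ) : ℂ :=
  (k * rayPoint τ u ^ (k - 1) + rayPoint τ u ^ (k + 2)) * cexp (rayPoint τ u ^ 3 / 3) *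
    (-1 + u * (sixthRoot - I)) * rayDir τ +
  rayPoint τ u ^ k * cexp (rayPoint τ u ^ 3 / 3) * (sixthRoot - I)

lemma hasDerivAt_ray_left (k : ℕ) (τ u : ℝ) :
    HasDerivAt (fun τ : ℝ => rayPoint τ u ^ k * cexp (rayPoint τ u ^ 3 / 3) * rayDir τ)
      (rayDeriv k τ u) τ := by
  have h := ((hasDerivAt_pow_mul_cexp k (rayPoint τ u)).comp τ (hasDerivAt_rayPoint_left τ u)).mul
    (hasDerivAt_rayDir τ)
  exact h

/-- The factor `-1 + u * (sixthRoot - I)` is ∂s/∂τ for s = `rayPoint τ u`. Together with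
`hasDerivAt_ray_left` this says that ∂_τ(f(s) ∂_u s) = ∂_u(f(s) ∂_τ s) for f(s) = s^k exp(s³/3),
which is what Cauchy's theorem needs. -/
lemma hasDerivAt_ray_right (k : ℕ) (τ u : ℝ) :
    HasDerivAt (fun u : ℝ => rayPoint τ u ^ k * cexp (rayPoint τ u ^ 3 / 3) *
      (-1 + u * (sixthRoot - I))) (rayDeriv k τ u) u := by
  have h0 := ((Complex.ofRealCLM.hasDerivAt (x := u)).mul_const (sixthRoot - I)).const_add (-1)
  have h := ((hasDerivAt_pow_mul_cexp k (rayPoint τ u)).comp u (hasDerivAt_rayPoint_right τ u)).mul h0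
  refine h.congr_deriv ?_
  simp only [rayDeriv, Complex.ofRealCLM_apply, Complex.ofReal_one, Function.comp_apply]
  ring

lemma norm_sixthRoot_sub_I : ‖sixthRoot - I‖ ≤ 2 := by
  refine (norm_sub_le _ _).trans ?_
  rw [norm_sixthRoot, norm_I]; norm_num

lemma norm_boundary_le {u : ℝ} (hu : 0 ≤ u) : ‖(-1 + u * (sixthRoot - I) : ℂ)‖ ≤ 2 * (1 + u) := by
  refine (norm_add_le _ _).trans ?_
  rw [norm_mul, norm_neg, norm_one, Complex.norm_real, Real.norm_of_nonneg hu]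
  nlinarith [norm_sixthRoot_sub_I]

lemma norm_rayDeriv_le (k : ℕ) {τ u : ℝ} (h0 : 0 ≤ τ) (h1 : τ ≤ 1) (hu : 0 ≤ u) :
    ‖rayDeriv k τ u‖ ≤ 2 * (k + 2) * ((1 + u) ^ (k + 3) * Real.exp (2 - u ^ 2 / 6)) := by
  have hs := norm_rayPoint_le h0 h1 hu
  have he := norm_cexp_rayPoint_le h0 h1 hu
  have hd := norm_rayDir_le h0 h1
  have hb := norm_boundary_le hu
  have hI := norm_sixthRoot_sub_I
  have hu1 : 1 ≤ 1 + u := by linarith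
  have hp1 : ‖(k * rayPoint τ u ^ (k - 1) + rayPoint τ u ^ (k + 2) : ℂ)‖ ≤
      (k + 1) * (1 + u) ^ (k + 2) := by
    refine (norm_add_le _ _).trans ?_
    rw [norm_mul, norm_pow, norm_pow, Complex.norm_natCast]
    have h2 : ‖rayPoint τ u‖ ^ (k - 1) ≤ (1 + u) ^ (k + 2) :=
      (pow_le_pow_left₀ (norm_nonneg _) hs _).trans (pow_le_pow_right₀ hu1 (by omega))
    have h3 : ‖rayPoint τ u‖ ^ (k + 2) ≤ (1 + u) ^ (k + 2) := pow_le_pow_left₀ (norm_nonneg _) hs _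
    have h4 : (k : ℝ) * ‖rayPoint τ u‖ ^ (k - 1) ≤ k * (1 + u) ^ (k + 2) := by gcongr
    linarith
  have hp2 : ‖rayPoint τ u ^ k‖ ≤ (1 + u) ^ (k + 3) := by
    rw [norm_pow]
    exact (pow_le_pow_left₀ (norm_nonneg _) hs _).trans (pow_le_pow_right₀ hu1 (by omega))
  refine (norm_add_le _ _).trans ?_
  rw [norm_mul, norm_mul, norm_mul, norm_mul (_ * _) (sixthRoot - I), norm_mul]
  calc _ ≤ ((k + 1) * (1 + u) ^ (k + 2)) * Real.exp (2 - u ^ 2 / 6) * (2 * (1 + u)) * 1 +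
        (1 + u) ^ (k + 3) * Real.exp (2 - u ^ 2 / 6) * 2 := by gcongr
    _ = _ := by ring

lemma continuous_rayPoint_left (u : ℝ) : Continuous fun τ => rayPoint τ u := by
  unfold rayPoint rayDir; fun_prop

lemma continuous_rayPoint_right (τ : ℝ) : Continuous fun u => rayPoint τ u := by
  unfold rayPoint rayDir; fun_prop

lemma continuous_rayDir : Continuous rayDir := by
  unfold rayDir; fun_prop

lemma continuous_rayDeriv (k : ℕ) (τ : ℝ) : Continuous (rayDeriv k τ) := by
  have := continuous_rayPoint_right τ
  unfold rayDeriv; fun_prop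

/-- The integral along the path with parameter `τ`. -/
def rayIntegral (k : ℕ) (τ : ℝ) : ℂ :=
  ∫ u in Set.Ioi (0 : ℝ), rayPoint τ u ^ k * cexp (rayPoint τ u ^ 3 / 3) * rayDir τ

lemma norm_ray_le (k : ℕ) {τ u : ℝ} (h0 : 0 ≤ τ) (h1 : τ ≤ 1) (hu : 0 ≤ u) :
    ‖rayPoint τ u ^ k * cexp (rayPoint τ u ^ 3 / 3) * rayDir τ‖ ≤
      (1 + u) ^ k * Real.exp (2 - u ^ 2 / 6) := by
  rw [norm_mul, norm_mul, norm_pow]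
  calc _ ≤ (1 + u) ^ k * Real.exp (2 - u ^ 2 / 6) * 1 := by
        gcongr
        · exact norm_rayPoint_le h0 h1 hu
        · exact norm_cexp_rayPoint_le h0 h1 hu
        · exact norm_rayDir_le h0 h1
    _ = _ := mul_one _

lemma continuous_ray (k : ℕ) (τ : ℝ) :
    Continuous fun u => rayPoint τ u ^ k * cexp (rayPoint τ u ^ 3 / 3) * rayDir τ := by
  have := continuous_rayPoint_right τ
  fun_prop

lemma integrableOn_ray (k : ℕ) {τ : ℝ} (h0 : 0 ≤ τ) (h1 : τ ≤ 1) :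
    IntegrableOn (fun u => rayPoint τ u ^ k * cexp (rayPoint τ u ^ 3 / 3) * rayDir τ)
      (Set.Ioi (0 : ℝ)) :=
  Integrable.mono' (integrable_one_add_pow_mul_exp k) (continuous_ray k τ).aestronglyMeasurable
    ((ae_restrict_mem measurableSet_Ioi).mono fun _ hu => norm_ray_le k h0 h1 (le_of_lt hu))

lemma continuousOn_rayIntegral (k : ℕ) : ContinuousOn (rayIntegral k) (Set.Icc 0 1) := by
  refine continuousOn_of_dominated (bound := fun u => (1 + u) ^ k * Real.exp (2 - u ^ 2 / 6))
    (fun τ _ => (continuous_ray k τ).aestronglyMeasurable) (fun τ hτ => ?_)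
    (integrable_one_add_pow_mul_exp k) (ae_of_all _ fun u => ?_)
  · exact (ae_restrict_mem measurableSet_Ioi).mono fun u hu => norm_ray_le k hτ.1 hτ.2 (le_of_lt hu)
  · have h1 := continuous_rayPoint_left u
    have h2 := continuous_rayDir
    exact Continuous.continuousOn (by fun_prop)

lemma tendsto_one_add_pow_mul_exp_neg_sq (n : ℕ) :
    Tendsto (fun u : ℝ => (1 + u) ^ n * Real.exp (2 - u ^ 2 / 6)) atTop (𝓝 0) := by
  have h := (Real.tendsto_exp_neg_atTop_nhds_zero.const_mul (n.factorial * Real.exp 9))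
  rw [mul_zero] at h
  refine squeeze_zero' ?_ ?_ h
  · filter_upwards [eventually_ge_atTop 0] with u hu
    positivity
  · filter_upwards [eventually_ge_atTop 0] with u hu
    have h1 := Real.pow_div_factorial_le_exp (1 + u) (by positivity) n
    rw [div_le_iff₀ (by positivity)] at h1
    calc _ ≤ (Real.exp (1 + u) * n.factorial) * Real.exp (2 - u ^ 2 / 6) := by gcongr
      _ = n.factorial * Real.exp ((1 + u) + (2 - u ^ 2 / 6)) := by rw [Real.exp_add (1 + u)]; ring
      _ ≤ n.factorial * Real.exp (9 + -u) := by
        refine mul_le_mul_of_nonneg_left (Real.exp_le_exp.2 ?_) (by positivity)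
        -- The constant 9 makes the difference of the exponents equal to (u - 6)²/6.
        nlinarith [sq_nonneg (u - 6)]
      _ = _ := by rw [Real.exp_add]; ring

/-- Only the boundary term at `u = 0` survives, where s = 1 - τ and ∂s/∂τ = -1. It is real. -/
lemma integral_rayDeriv (k : ℕ) {τ : ℝ} (h0 : 0 ≤ τ) (h1 : τ ≤ 1) :
    ∫ u in Set.Ioi (0 : ℝ), rayDeriv k τ u = ((1 - τ) ^ k * Real.exp ((1 - τ) ^ 3 / 3) : ℝ) := by
  have hint : IntegrableOn (rayDeriv k τ) (Set.Ioi 0) :=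
    Integrable.mono' ((integrable_one_add_pow_mul_exp (k + 3)).const_mul (2 * (k + 2)))
      (continuous_rayDeriv k τ).aestronglyMeasurable
      ((ae_restrict_mem measurableSet_Ioi).mono fun _ hu => norm_rayDeriv_le k h0 h1 (le_of_lt hu))
  have hlim : Tendsto (fun u : ℝ => rayPoint τ u ^ k * cexp (rayPoint τ u ^ 3 / 3) *
      (-1 + u * (sixthRoot - I))) atTop (𝓝 0) := by
    have h2 := (tendsto_one_add_pow_mul_exp_neg_sq (k + 1)).const_mul 2
    rw [mul_zero] at h2
    refine squeeze_zero_norm' ?_ h2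
    filter_upwards [eventually_ge_atTop 0] with u hu
    rw [norm_mul, norm_mul, norm_pow]
    calc _ ≤ (1 + u) ^ k * Real.exp (2 - u ^ 2 / 6) * (2 * (1 + u)) := by
          gcongr
          · exact norm_rayPoint_le h0 h1 hu
          · exact norm_cexp_rayPoint_le h0 h1 hu
          · exact norm_boundary_le hu
      _ = _ := by ring
  rw [integral_Ioi_of_hasDerivAt_of_tendsto' (fun u _ => hasDerivAt_ray_right k τ u) hint hlim]
  simp [rayPoint]

lemma hasDerivAt_rayIntegral (k : ℕ) {τ : ℝ} (hτ : τ ∈ Set.Ioo (0 : ℝ) 1) :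
    HasDerivAt (rayIntegral k) ((1 - τ) ^ k * Real.exp ((1 - τ) ^ 3 / 3) : ℝ) τ := by
  rw [← integral_rayDeriv k hτ.1.le hτ.2.le]
  refine (hasDerivAt_integral_of_dominated_loc_of_deriv_le (Ioo_mem_nhds hτ.1 hτ.2)
    (bound := fun u => 2 * (k + 2) * ((1 + u) ^ (k + 3) * Real.exp (2 - u ^ 2 / 6)))
    (Eventually.of_forall fun τ => (continuous_ray k τ).aestronglyMeasurable)
    (integrableOn_ray k hτ.1.le hτ.2.le) (continuous_rayDeriv k τ).aestronglyMeasurable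
    ?_ ((integrable_one_add_pow_mul_exp (k + 3)).const_mul _)
    (ae_of_all _ fun u σ _ => hasDerivAt_ray_left k σ u)).2
  exact (ae_restrict_mem measurableSet_Ioi).mono fun u hu σ hσ =>
    norm_rayDeriv_le k hσ.1.le hσ.2.le (le_of_lt hu)

/-- The starting point of the path moves along the real axis, so the integral changes only by a real
amount. -/
lemma rayIntegral_im_eq (k : ℕ) : (rayIntegral k 0).im = (rayIntegral k 1).im := by
  have hc : ContinuousOn (fun τ => (rayIntegral k τ).im) (Set.Icc 0 1) :=
    Complex.continuous_im.comp_continuousOn (continuousOn_rayIntegral k)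
  have hd : ∀ τ ∈ Set.Ioo (0 : ℝ) 1, HasDerivAt (fun τ => (rayIntegral k τ).im) 0 τ := by
    intro τ hτ
    have := Complex.imCLM.hasFDerivAt.comp_hasDerivAt τ (hasDerivAt_rayIntegral k hτ)
    refine this.congr_deriv ?_
    rw [Complex.imCLM_apply, Complex.ofReal_im]
  obtain ⟨c, -, h⟩ := exists_hasDerivAt_eq_slope _ (fun _ => 0) zero_lt_one hc hd
  simp at h
  linarith

lemma rayIntegral_one (k : ℕ) : rayIntegral k 1 =
    sixthRoot ^ (k + 1) * (∫ u in Set.Ioi (0 : ℝ), u ^ k * Real.exp (-(1 / 3) * u ^ 3) : ℝ) := by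
  rw [rayIntegral, ← integral_complex_ofReal, ← integral_const_mul]
  refine integral_congr_ae (ae_of_all _ fun u => ?_)
  have e1 : rayPoint 1 u = u * sixthRoot := by simp [rayPoint, rayDir]
  have e2 : rayDir 1 = sixthRoot := by simp [rayDir]
  have e3 : (u * sixthRoot : ℂ) ^ 3 / 3 = -(1 / 3) * u ^ 3 := by
    rw [mul_pow, sixthRoot_cube]; ring
  simp only [e1, e2, e3]
  push_cast
  ring

/-- The half lines contribute conjugate values, so the integral is twice a real part; the factor `I`
from ds = i du turns it into the imaginary part of `rayIntegral k 0`, which is invariant under the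
rotation. -/
lemma integral_critical (k : ℕ) :
    ∫ u : ℝ, (1 + u * I) ^ k * cexp ((1 + u * I) ^ 3 / 3) = ((2 * (rayIntegral k 1).im : ℝ) : ℂ) := by
  set g : ℝ → ℂ := fun u => (1 + u * I) ^ k * cexp ((1 + u * I) ^ 3 / 3) with hg
  have hray : ∀ u, rayPoint 0 u ^ k * cexp (rayPoint 0 u ^ 3 / 3) * rayDir 0 = g u * I := by
    intro u; simp [rayPoint, rayDir, hg]
  have hIoi : IntegrableOn g (Set.Ioi 0) := by
    have h := (integrableOn_ray k le_rfl zero_le_one).mul_const (-I)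
    refine h.congr (ae_of_all _ fun u => ?_)
    dsimp only
    rw [hray, mul_assoc]; simp
  have hconj : ∀ u, g (-u) = (starRingEnd ℂ) (g u) := by
    intro u
    simp only [hg, map_mul, map_pow, ← Complex.exp_conj, map_div₀, map_add, map_one, conj_ofReal,
      conj_I, Complex.ofReal_neg, map_ofNat]
    ring_nf
  have hIic : IntegrableOn g (Set.Iic 0) := by
    rw [integrableOn_Iic_iff_integrableOn_Iio]
    have : IntegrableOn (fun u => g (-u)) (Set.Ioi 0) := by
      simp only [hconj]
      exact (Complex.conjLIE.integrable_comp_iff).2 hIoi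
    have h2 := this.comp_neg
    simpa using h2
  have h0 : ∫ u in Set.Iic (0 : ℝ), g u = (starRingEnd ℂ) (∫ u in Set.Ioi (0 : ℝ), g u) := by
    rw [← integral_conj]
    simp only [← hconj]
    rw [integral_comp_neg_Ioi, neg_zero]
  have h1 : rayIntegral k 0 = (∫ u in Set.Ioi (0 : ℝ), g u) * I := by
    rw [rayIntegral, ← integral_mul_const]
    exact integral_congr_ae (ae_of_all _ hray)
  rw [← intervalIntegral.integral_Iic_add_Ioi hIic hIoi, h0, add_comm, Complex.add_conj,
    ← rayIntegral_im_eq, h1]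
  simp

lemma integral_pow_mul_exp (k : ℕ) : ∫ u in Set.Ioi (0 : ℝ), u ^ k * Real.exp (-(1 / 3) * u ^ 3) =
    3 ^ (((k : ℝ) + 1) / 3) * (1 / 3) * Real.Gamma ((k + 1) / 3) := by
  have h := _root_.integral_rpow_mul_exp_neg_mul_rpow (p := 3) (q := k) (b := 1 / 3) (by norm_num)
    (by have : (0 : ℝ) ≤ k := by positivity
        linarith) (by norm_num)
  have e : (1 / 3 : ℝ) ^ (-((k : ℝ) + 1) / 3) = 3 ^ (((k : ℝ) + 1) / 3) := by
    rw [one_div, Real.inv_rpow (by norm_num), ← Real.rpow_neg (by norm_num)]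
    congr 1; ring
  rw [← e, ← h]
  refine integral_congr_ae (ae_of_all _ fun u => ?_)
  norm_cast

lemma integral_critical_zero : ∫ u : ℝ, (1 + u * I) ^ 0 * cexp ((1 + u * I) ^ 3 / 3) =
    ((3 ^ (5 / 6 : ℝ) * Real.Gamma (4 / 3) : ℝ) : ℂ) := by
  rw [integral_critical, rayIntegral_one, integral_pow_mul_exp, Complex.im_mul_ofReal]
  congr 1
  have h1 : (4 / 3 : ℝ) = 1 / 3 + 1 := by norm_num
  have h2 : (3 : ℝ) ^ (5 / 6 : ℝ) = √3 * 3 ^ (1 / 3 : ℝ) := by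
    rw [Real.sqrt_eq_rpow, ← Real.rpow_add (by norm_num)]; norm_num
  rw [h1, Real.Gamma_add_one (by norm_num), h2]
  simp [sixthRoot]
  ring

lemma integral_critical_one : ∫ u : ℝ, (1 + u * I) ^ 1 * cexp ((1 + u * I) ^ 3 / 3) =
    ((3 ^ (1 / 6 : ℝ) * Real.Gamma (2 / 3) : ℝ) : ℂ) := by
  rw [integral_critical, rayIntegral_one, integral_pow_mul_exp, Complex.im_mul_ofReal]
  congr 1
  have h2 : (3 : ℝ) ^ (1 / 6 : ℝ) = √3 * 3 ^ (2 / 3 : ℝ) / 3 := by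
    rw [Real.sqrt_eq_rpow, ← Real.rpow_add (by norm_num), ← Real.rpow_sub_one (by norm_num)]
    norm_num
  rw [sixthRoot_sq, h2]
  norm_num
  ring

end Airy
end ArborealGas
end

/-! ### Integral representations of the partition function and the tree sum -/

noncomputable section

namespace ArborealGas

open MeasureTheory Complex
open scoped Real Topology

section Representation

lemma integrable_line_mul {K : ℝ} (hK : 0 < K) {a C : ℝ} (m : ℝ) (n : ℕ) {H : ℂ → ℂ}
    (hcont : Continuous fun y : ℝ => H (a + y * I)) (hC : ∀ y : ℝ, ‖H (a + y * I)‖ ≤ C) :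
    Integrable fun y : ℝ =>
      (a + y * I : ℂ) ^ n * cexp (K * (a + y * I - m) ^ 2) * H (a + y * I) := by
  refine ((integrable_line hK a m n).norm.mul_const C).mono'
    ((continuous_line K a m n).mul hcont).aestronglyMeasurable (ae_of_all _ fun y => ?_)
  rw [norm_mul]
  gcongr
  exact hC y

lemma line_ne_zero {a : ℝ} (ha : 0 < a) (y : ℝ) : (a + y * I : ℂ) ≠ 0 := by
  intro h
  have := congrArg Complex.re h
  simp at this
  exact ha.ne' this

lemma continuous_line_inv {a : ℝ} (ha : 0 < a) : Continuous fun y : ℝ => (a + y * I : ℂ)⁻¹ :=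
  Continuous.inv₀ (by fun_prop) (line_ne_zero ha)

lemma norm_line_inv_le {a : ℝ} (ha : 0 < a) (y : ℝ) : ‖(a + y * I : ℂ)⁻¹‖ ≤ a⁻¹ := by
  rw [norm_inv]
  gcongr
  have := Complex.re_le_norm (a + y * I : ℂ)
  simpa using this

/-- The expected tree size is the ratio of this quantity and the partition function. -/
def treeSum (α : ℝ) (N : ℕ) : ℝ := hermiteSeq (1 + N * (α / N)) (α / N) (N - 1)

variable {α : ℝ} {N : ℕ}

/-- The choice K = N/(2α) makes the variance 1/(2K) equal to β = α/N. -/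
lemma hermiteSeq_eq_integral (hα : 0 < α) (hN : 0 < N) (a : ℝ) (n : ℕ) :
    (hermiteSeq (1 + N * (α / N)) (α / N) n : ℂ) = ((√N / √(2 * π * α) : ℝ) : ℂ) *
      ∫ y : ℝ, (a + y * I : ℂ) ^ n *
        cexp (((N / (2 * α) : ℝ) : ℂ) * (a + y * I - (1 + α : ℝ)) ^ 2) := by
  have hN' : (0 : ℝ) < N := by exact_mod_cast hN
  rw [integral_line (by positivity)]
  have e1 : (1 / (2 * (N / (2 * α))) : ℝ) = α / N := by field_simp
  have e2 : (1 + N * (α / N) : ℝ) = 1 + α := by field_simp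
  have e3 : (√N / √(2 * π * α) : ℝ) * √(π / (N / (2 * α))) = 1 := by
    have : π / (N / (2 * α)) = (2 * π * α) / N := by field_simp
    rw [this, Real.sqrt_div (by positivity)]
    have h1 : 0 < √(N : ℝ) := Real.sqrt_pos.2 hN'
    have h2 : 0 < √(2 * π * α) := Real.sqrt_pos.2 (by positivity)
    field_simp
  rw [e1, e2, ← mul_assoc, ← Complex.ofReal_mul, e3, Complex.ofReal_one, one_mul]

lemma treeSum_eq_integral (hα : 0 < α) (hN : 0 < N) {a : ℝ} (ha : 0 < a) :
    (treeSum α N : ℂ) = ((√N / √(2 * π * α) : ℝ) : ℂ) *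
      ∫ y : ℝ, (a + y * I : ℂ) ^ N *
        cexp (((N / (2 * α) : ℝ) : ℂ) * (a + y * I - (1 + α : ℝ)) ^ 2) * (a + y * I : ℂ)⁻¹ := by
  rw [treeSum, hermiteSeq_eq_integral hα hN a]
  congr 1
  refine integral_congr_ae (ae_of_all _ fun y => ?_)
  obtain ⟨n, rfl⟩ : ∃ n, N = n + 1 := ⟨N - 1, by omega⟩
  have := line_ne_zero ha y
  simp only [Nat.add_sub_cancel]
  field_simp
  ring

lemma partitionFunction_eq_integral (hα : 0 < α) (hN : 0 < N) {a : ℝ} (ha : 0 < a) :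
    (partitionFunction (⊤ : SimpleGraph (Fin N)) (α / N) : ℂ) = ((√N / √(2 * π * α) : ℝ) : ℂ) *
      ∫ y : ℝ, (a + y * I : ℂ) ^ N *
        cexp (((N / (2 * α) : ℝ) : ℂ) * (a + y * I - (1 + α : ℝ)) ^ 2) *
          (1 - α * (a + y * I : ℂ)⁻¹) := by
  have hN' : (0 : ℝ) < N := by exact_mod_cast hN
  have hK : 0 < N / (2 * α) := by positivity
  have h1 := treeSum_eq_integral hα hN ha
  have h2 := integrable_line_mul hK (1 + α) N (H := fun w => w⁻¹) (continuous_line_inv ha)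
    (norm_line_inv_le ha)
  have e : (N * (α / N) : ℝ) = α := by field_simp
  have h3 : partitionFunction (⊤ : SimpleGraph (Fin N)) (α / N) =
      hermiteSeq (1 + N * (α / N)) (α / N) N - α * treeSum α N := by
    rw [partitionFunction_eq, treeSum, e]
  rw [h3, Complex.ofReal_sub, Complex.ofReal_mul, h1, hermiteSeq_eq_integral hα hN a, mul_left_comm,
    ← mul_sub, ← integral_const_mul, ← integral_sub (integrable_line hK a (1 + α) N)
      (h2.const_mul _)]
  congr 1
  refine integral_congr_ae (ae_of_all _ fun y => ?_)
  dsimp only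
  ring

/-- Integration by parts on the line through `α`, where the leading contribution cancels. -/
lemma integral_by_parts (hα : 1 < α) (hN : 0 < N) :
    ∫ y : ℝ, (α + y * I : ℂ) ^ N *
        cexp (((N / (2 * α) : ℝ) : ℂ) * (α + y * I - (1 + α : ℝ)) ^ 2) *
          (1 - α * (α + y * I : ℂ)⁻¹) =
      (α / N : ℝ) * ∫ y : ℝ, (α + y * I : ℂ) ^ N *
        cexp (((N / (2 * α) : ℝ) : ℂ) * (α + y * I - (1 + α : ℝ)) ^ 2) *
          ((α + y * I - 1 : ℂ)⁻¹) ^ 2 := by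
  have hα0 : 0 < α := by linarith
  have hα1 : 0 < α - 1 := by linarith
  have hN' : (0 : ℝ) < N := by exact_mod_cast hN
  have hK : 0 < N / (2 * α) := by positivity
  have hsub : ∀ y : ℝ, (α + y * I - 1 : ℂ) = ((α - 1 : ℝ) : ℂ) + y * I := fun y => by
    push_cast; ring
  have hne : ∀ y : ℝ, (α + y * I - 1 : ℂ) ≠ 0 := fun y => by
    rw [hsub]; exact line_ne_zero hα1 y
  have hcont : Continuous fun y : ℝ => (α + y * I - 1 : ℂ)⁻¹ := by
    simp only [hsub]; exact continuous_line_inv hα1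
  have hbd : ∀ y : ℝ, ‖(α + y * I - 1 : ℂ)⁻¹‖ ≤ (α - 1)⁻¹ := fun y => by
    rw [hsub]; exact norm_line_inv_le hα1 y
  have i1 := integrable_line_mul hK (1 + α) N (H := fun w => (w - 1)⁻¹) hcont hbd
  have i2 := integrable_line_mul hK (1 + α) N (H := fun w => ((w - 1)⁻¹) ^ 2) (hcont.pow 2)
    (C := ((α - 1)⁻¹) ^ 2)
    (fun y => by rw [norm_pow]; exact pow_le_pow_left₀ (norm_nonneg _) (hbd y) 2)
  have i3 := integrable_line_mul hK (1 + α) N (H := fun w => 1 - α * w⁻¹)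
    ((continuous_const.sub (continuous_const.mul (continuous_line_inv hα0)))) (C := 1 + α * α⁻¹)
    (fun y => by
      refine (norm_sub_le _ _).trans ?_
      rw [norm_one, norm_mul, Complex.norm_real, Real.norm_of_nonneg hα0.le]
      gcongr
      exact norm_line_inv_le hα0 y)
  -- Since φ'(w) = (w - 1)(w - α)/(αw), the prefactor 1 - α/w equals αφ'(w)/(w - 1), so e^{Nφ}/(w -
  -- 1) is the function to differentiate. It has no pole on the line because α > 1.
  have hd : ∀ y : ℝ, HasDerivAt (fun y : ℝ => (α + y * I : ℂ) ^ N *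
      cexp (((N / (2 * α) : ℝ) : ℂ) * (α + y * I - (1 + α : ℝ)) ^ 2) * (α + y * I - 1 : ℂ)⁻¹)
      (I * ((N / α : ℝ) * ((α + y * I : ℂ) ^ N *
        cexp (((N / (2 * α) : ℝ) : ℂ) * (α + y * I - (1 + α : ℝ)) ^ 2) *
          (1 - α * (α + y * I : ℂ)⁻¹)) - (α + y * I : ℂ) ^ N *
        cexp (((N / (2 * α) : ℝ) : ℂ) * (α + y * I - (1 + α : ℝ)) ^ 2) *
          ((α + y * I - 1 : ℂ)⁻¹) ^ 2)) y := by
    intro y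
    have h1 : HasDerivAt (fun y : ℝ => (α + y * I - 1 : ℂ)) I y := by
      simpa using (((Complex.ofRealCLM.hasDerivAt (x := y)).mul_const I).const_add (α : ℂ)).sub_const 1
    have h1' : HasDerivAt (fun y : ℝ => (α + y * I - 1 : ℂ)⁻¹) (-I / (α + y * I - 1) ^ 2) y :=
      h1.inv (hne y)
    have h2 := (hasDerivAt_line (N / (2 * α)) α (1 + α) y N).mul h1'
    refine HasDerivAt.congr_deriv (f := fun y : ℝ => (α + y * I : ℂ) ^ N *
      cexp (((N / (2 * α) : ℝ) : ℂ) * (α + y * I - (1 + α : ℝ)) ^ 2) * (α + y * I - 1 : ℂ)⁻¹) h2 ?_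
    obtain ⟨n, rfl⟩ : ∃ n, N = n + 1 := ⟨N - 1, by omega⟩
    have h3 := hne y
    have h4 := line_ne_zero hα0 y
    have h5 : (α : ℂ) ≠ 0 := by exact_mod_cast hα0.ne'
    simp only [Nat.add_sub_cancel]
    push_cast
    generalize cexp _ = e
    generalize (α + y * I : ℂ) = w at h3 h4 ⊢
    field_simp
    ring
  have h := integral_eq_zero_of_hasDerivAt_of_integrable hd
    (((i3.const_mul ((N / α : ℝ) : ℂ)).sub i2).const_mul I) i1
  rw [integral_const_mul, integral_sub (i3.const_mul _) i2, integral_const_mul] at h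
  have h6 := sub_eq_zero.1 ((mul_eq_zero.1 h).resolve_left I_ne_zero)
  rw [← h6, ← mul_assoc, ← Complex.ofReal_mul]
  have : α / N * (N / α) = 1 := by field_simp
  rw [this, Complex.ofReal_one, one_mul]

end Representation

/-! ### Limits of the tree sum and the partition function -/

section Asymptotics

lemma sqrt_laplace {α κ : ℝ} (hα : 0 < α) (hκ : 0 < κ) :
    √(2 * π / κ) / √(2 * π * α) = 1 / √(α * κ) := by
  have h : 2 * π / κ / (2 * π * α) = 1 / (α * κ) := by
    have := Real.pi_pos.ne'
    field_simp
  rw [← Real.sqrt_div (by positivity), h, Real.sqrt_div zero_le_one, Real.sqrt_one]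

/-- The real form of Laplace's method, for a sequence that is given by an integral on a line. -/
lemma tendsto_of_eq_integral {α a C L : ℝ} (hα : 0 < α) (ha : 0 < a) (haα : α < a ^ 2)
    (ham : a * (1 + α - a) = α) {H : ℂ → ℂ} (hcont : Continuous fun y : ℝ => H (a + y * I))
    (hC : ∀ y : ℝ, ‖H (a + y * I)‖ ≤ C) (hL : H a = L) {f : ℕ → ℝ}
    (hf : ∀ N : ℕ, 0 < N → (f N : ℂ) = ((√N / √(2 * π * α) : ℝ) : ℂ) *
      ∫ y : ℝ, (a + y * I : ℂ) ^ N *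
        cexp (((N / (2 * α) : ℝ) : ℂ) * (a + y * I - (1 + α : ℝ)) ^ 2) * H (a + y * I)) :
    Tendsto (fun N : ℕ => f N / (a ^ N * Real.exp (N / (2 * α) * (a - (1 + α)) ^ 2))) atTop
      (𝓝 (L / √(1 - α / a ^ 2))) := by
  have hκ : 0 < 1 / α - 1 / a ^ 2 := sub_pos.2 (one_div_lt_one_div_of_lt hα haα)
  have h := (tendsto_integral_line hα ha haα ham hcont hC).div_const ((√(2 * π * α) : ℝ) : ℂ)
  have hlim : H a * (√(2 * π / (1 / α - 1 / a ^ 2)) : ℝ) / ((√(2 * π * α) : ℝ) : ℂ) =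
      ((L / √(1 - α / a ^ 2) : ℝ) : ℂ) := by
    have e : α * (1 / α - 1 / a ^ 2) = 1 - α / a ^ 2 := by field_simp
    rw [hL, ← e, ← mul_one_div L, ← sqrt_laplace hα hκ]
    push_cast; ring
  rw [hlim] at h
  have h2 := (Complex.continuous_re.tendsto _).comp h
  rw [Complex.ofReal_re] at h2
  refine h2.congr' ?_
  filter_upwards [eventually_gt_atTop 0] with N hN
  have e : ((f N / (a ^ N * Real.exp (N / (2 * α) * (a - (1 + α)) ^ 2)) : ℝ) : ℂ) =
      ((√N : ℝ) : ℂ) * (∫ y : ℝ, (a + y * I : ℂ) ^ N *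
        cexp (((N / (2 * α) : ℝ) : ℂ) * (a + y * I - (1 + α : ℝ)) ^ 2) * H (a + y * I) /
        ((a ^ N * Real.exp (N / (2 * α) * (a - (1 + α)) ^ 2) : ℝ) : ℂ)) /
          ((√(2 * π * α) : ℝ) : ℂ) := by
    rw [Complex.ofReal_div (f N), hf N hN, integral_div, Complex.ofReal_div (√N)]
    ring
  rw [Function.comp_apply, ← e, Complex.ofReal_re]

lemma tendsto_treeSum_subcritical {α : ℝ} (hα : 0 < α) (hα1 : α < 1) :
    Tendsto (fun N : ℕ => treeSum α N / Real.exp (N * α / 2)) atTop (𝓝 (1 / √(1 - α))) := by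
  have h := tendsto_of_eq_integral (a := 1) (L := 1) (H := fun w => w⁻¹) (f := treeSum α) hα one_pos
    (by simpa using hα1) (by ring) (continuous_line_inv one_pos) (norm_line_inv_le one_pos) (by simp)
    (fun N hN => treeSum_eq_integral hα hN one_pos)
  simp only [one_pow, div_one, one_mul] at h
  refine h.congr fun N => ?_
  congr 2
  field_simp
  ring

lemma norm_one_sub_mul_line_inv_le {α a : ℝ} (hα : 0 < α) (ha : 0 < a) (y : ℝ) :
    ‖(1 - α * (a + y * I)⁻¹ : ℂ)‖ ≤ 1 + α * a⁻¹ := by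
  refine (norm_sub_le _ _).trans ?_
  rw [norm_one, norm_mul, Complex.norm_real, Real.norm_of_nonneg hα.le]
  gcongr
  exact norm_line_inv_le ha y

lemma tendsto_partitionFunction_subcritical {α : ℝ} (hα : 0 < α) (hα1 : α < 1) :
    Tendsto (fun N : ℕ => partitionFunction (⊤ : SimpleGraph (Fin N)) (α / N) /
      Real.exp (N * α / 2)) atTop (𝓝 √(1 - α)) := by
  have h := tendsto_of_eq_integral (a := 1) (L := 1 - α) (H := fun w => 1 - α * w⁻¹)
    (f := fun N => partitionFunction (⊤ : SimpleGraph (Fin N)) (α / N)) hα one_pos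
    (by simpa using hα1) (by ring)
    (continuous_const.sub (continuous_const.mul (continuous_line_inv one_pos)))
    (norm_one_sub_mul_line_inv_le hα one_pos) (by simp)
    (fun N hN => partitionFunction_eq_integral hα hN one_pos)
  simp only [one_pow, div_one, one_mul, Real.div_sqrt] at h
  refine h.congr fun N => ?_
  congr 2
  field_simp
  ring

lemma exp_supercritical (α : ℝ) (N : ℕ) :
    Real.exp (N / (2 * α) * (α - (1 + α)) ^ 2) = Real.exp (N / (2 * α)) := by
  congr 1; ring

lemma tendsto_treeSum_supercritical {α : ℝ} (hα : 1 < α) :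
    Tendsto (fun N : ℕ => treeSum α N / (α ^ N * Real.exp (N / (2 * α)))) atTop
      (𝓝 (α⁻¹ / √(1 - α / α ^ 2))) := by
  have hα0 : 0 < α := by linarith
  have h := tendsto_of_eq_integral (a := α) (L := α⁻¹) (H := fun w => w⁻¹) (f := treeSum α) hα0 hα0
    (by nlinarith) (by ring) (continuous_line_inv hα0) (norm_line_inv_le hα0) (by simp)
    (fun N hN => treeSum_eq_integral hα0 hN hα0)
  simpa only [exp_supercritical α] using h

lemma tendsto_partitionFunction_supercritical {α : ℝ} (hα : 1 < α) :
    Tendsto (fun N : ℕ => N * partitionFunction (⊤ : SimpleGraph (Fin N)) (α / N) /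
      (α ^ N * Real.exp (N / (2 * α)))) atTop
      (𝓝 (α * ((α - 1)⁻¹) ^ 2 / √(1 - α / α ^ 2))) := by
  have hα0 : 0 < α := by linarith
  have hα1 : 0 < α - 1 := by linarith
  have hsub : ∀ y : ℝ, (α + y * I - 1 : ℂ) = ((α - 1 : ℝ) : ℂ) + y * I := fun y => by
    push_cast; ring
  have h := tendsto_of_eq_integral (a := α) (L := α * ((α - 1)⁻¹) ^ 2)
    (H := fun w => α * ((w - 1)⁻¹) ^ 2) (C := α * ((α - 1)⁻¹) ^ 2)
    (f := fun N => N * partitionFunction (⊤ : SimpleGraph (Fin N)) (α / N)) hα0 hα0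
    (by nlinarith) (by ring)
    (by simp only [hsub]; exact continuous_const.mul ((continuous_line_inv hα1).pow 2))
    (fun y => by
      rw [norm_mul, Complex.norm_real, Real.norm_of_nonneg hα0.le, norm_pow, hsub]
      gcongr
      exact norm_line_inv_le hα1 y) (by push_cast; rfl)
    (fun N hN => by
      have hN' : (N : ℂ) ≠ 0 := by exact_mod_cast hN.ne'
      have e : ∀ z : ℝ, (α + z * I : ℂ) ^ N *
          cexp (((N / (2 * α) : ℝ) : ℂ) * (α + z * I - (1 + α : ℝ)) ^ 2) *
            (α * ((α + z * I - 1)⁻¹) ^ 2) = α * ((α + z * I : ℂ) ^ N *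
          cexp (((N / (2 * α) : ℝ) : ℂ) * (α + z * I - (1 + α : ℝ)) ^ 2) *
            ((α + z * I - 1)⁻¹) ^ 2) := fun z => by ring
      rw [Complex.ofReal_mul, partitionFunction_eq_integral hα0 hN hα0, integral_by_parts hα hN,
        integral_congr_ae (ae_of_all _ e), integral_const_mul]
      have e2 : ∀ c J : ℂ, ((N : ℝ) : ℂ) * (c * ((α / N : ℝ) * J)) = c * (α * J) := fun c J => by
        push_cast; field_simp
      exact e2 _ _)
  simpa only [exp_supercritical α] using h

/-- The real form of the critical limit. -/
lemma tendsto_critical_of_eq_integral (k : ℕ) {A : ℝ} {f : ℕ → ℝ}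
    (hA : ∫ u : ℝ, (1 + u * I) ^ k * cexp ((1 + u * I) ^ 3 / 3) = A)
    (hf : ∀ N : ℕ, 0 < N → (f N : ℂ) = ((√N / √(2 * π) : ℝ) : ℂ) *
      ∫ y : ℝ, (((1 + (N : ℝ) ^ (-1 / 3 : ℝ) : ℝ) : ℂ) + y * I) ^ N *
        cexp (((N / 2 : ℝ) : ℂ) * (((1 + (N : ℝ) ^ (-1 / 3 : ℝ) : ℝ) : ℂ) + y * I - (2 : ℝ)) ^ 2) *
        ((1 + (((N : ℝ) ^ (1 / 3 : ℝ) * y : ℝ) : ℂ) * I) ^ k /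
          (((1 + (N : ℝ) ^ (-1 / 3 : ℝ) : ℝ) : ℂ) + y * I))) :
    Tendsto (fun N : ℕ => f N / ((N : ℝ) ^ (1 / 6 : ℝ) * Real.exp (N / 2))) atTop
      (𝓝 (A / √(2 * π))) := by
  have h := tendsto_integral_line_critical k
  rw [hA] at h
  have h2 := ((Complex.continuous_re.tendsto _).comp h).div_const (√(2 * π))
  rw [Complex.ofReal_re] at h2
  refine h2.congr' ?_
  filter_upwards [eventually_gt_atTop 0] with N hN
  have hN' : (0 : ℝ) < N := by exact_mod_cast hN
  have e : √(N : ℝ) = (N : ℝ) ^ (1 / 3 : ℝ) * (N : ℝ) ^ (1 / 6 : ℝ) := by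
    rw [Real.sqrt_eq_rpow, ← Real.rpow_add hN']; norm_num
  have h6 : (N : ℝ) ^ (1 / 6 : ℝ) ≠ 0 := (Real.rpow_pos_of_pos hN' _).ne'
  have h6' : (((N : ℝ) ^ (1 / 6 : ℝ) : ℝ) : ℂ) ≠ 0 := by exact_mod_cast h6
  have e2 : ∀ J : ℂ, ((√N / √(2 * π) : ℝ) : ℂ) * J =
      ((N : ℝ) ^ (1 / 6 : ℝ) * Real.exp (N / 2) / √(2 * π) : ℝ) *
        ((((N : ℝ) ^ (1 / 3 : ℝ) : ℝ) : ℂ) * (J / (Real.exp (N / 2) : ℝ))) := fun J => by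
    have : ((Real.exp (N / 2) : ℝ) : ℂ) ≠ 0 := by exact_mod_cast (Real.exp_pos _).ne'
    rw [e, Complex.ofReal_div, Complex.ofReal_div, Complex.ofReal_mul, Complex.ofReal_mul]
    field_simp
  have h7 := congrArg Complex.re (hf N hN)
  rw [e2, Complex.ofReal_re, Complex.re_ofReal_mul, ← integral_div] at h7
  rw [h7, Function.comp_apply]
  have := (Real.exp_pos (N / 2 : ℝ)).ne'
  generalize Complex.re _ = J
  field_simp

lemma tendsto_treeSum_critical :
    Tendsto (fun N : ℕ => treeSum 1 N / ((N : ℝ) ^ (1 / 6 : ℝ) * Real.exp (N / 2))) atTop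
      (𝓝 (3 ^ (5 / 6 : ℝ) * Real.Gamma (4 / 3) / √(2 * π))) := by
  refine tendsto_critical_of_eq_integral 0 integral_critical_zero fun N hN => ?_
  have hN' : (0 : ℝ) < N := by exact_mod_cast hN
  have ha : 0 < 1 + (N : ℝ) ^ (-1 / 3 : ℝ) := by positivity
  rw [treeSum_eq_integral one_pos hN ha]
  norm_num

/-- The prefactor of Z is (w - 1)/w, and N^{1/3}(w - 1) = 1 + iu in the scaled variable: hence the
case `k = 1`, and the extra N^{1/3} relative to the tree sum. -/
lemma tendsto_partitionFunction_critical :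
    Tendsto (fun N : ℕ => (N : ℝ) ^ (1 / 3 : ℝ) *
      partitionFunction (⊤ : SimpleGraph (Fin N)) (1 / N) /
        ((N : ℝ) ^ (1 / 6 : ℝ) * Real.exp (N / 2))) atTop
      (𝓝 (3 ^ (1 / 6 : ℝ) * Real.Gamma (2 / 3) / √(2 * π))) := by
  refine tendsto_critical_of_eq_integral 1 integral_critical_one fun N hN => ?_
  have hN' : (0 : ℝ) < N := by exact_mod_cast hN
  have ha : 0 < 1 + (N : ℝ) ^ (-1 / 3 : ℝ) := by positivity
  rw [Complex.ofReal_mul, partitionFunction_eq_integral one_pos hN ha, mul_left_comm,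
    ← integral_const_mul, mul_one]
  congr 1
  refine integral_congr_ae (ae_of_all _ fun y => ?_)
  have hw := line_ne_zero ha y
  have hδ : (((N : ℝ) ^ (1 / 3 : ℝ) : ℝ) : ℂ) * (((N : ℝ) ^ (-1 / 3 : ℝ) : ℝ) : ℂ) = 1 := by
    rw [← Complex.ofReal_mul, ← Real.rpow_add hN']; norm_num
  have hs : (1 + (((N : ℝ) ^ (1 / 3 : ℝ) * y : ℝ) : ℂ) * I) = (((N : ℝ) ^ (1 / 3 : ℝ) : ℝ) : ℂ) *
      ((((1 + (N : ℝ) ^ (-1 / 3 : ℝ) : ℝ) : ℂ) + y * I) - 1) := by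
    push_cast; linear_combination -hδ
  have h2 : ((1 + 1 : ℝ) : ℂ) = (2 : ℝ) := by norm_num
  dsimp only
  rw [pow_one, hs, h2, mul_one]
  generalize (((1 + (N : ℝ) ^ (-1 / 3 : ℝ) : ℝ) : ℂ) + y * I) = w at hw
  generalize (((N : ℝ) ^ (1 / 3 : ℝ) : ℝ) : ℂ) = t
  generalize cexp _ = e
  rw [Complex.ofReal_one]
  field_simp

end Asymptotics
end ArborealGas
end

/-! ### Asymptotics of the observables -/

noncomputable section

namespace ArborealGas

open scoped Real Topology

section Conclusion

/-- The expected number of vertices of the tree of a vertex of `K_N`. -/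
def meanTreeSize (α : ℝ) (N : ℕ) : ℝ :=
  treeSum α N / partitionFunction (⊤ : SimpleGraph (Fin N)) (α / N)

lemma expectedTreeVertices_eq_meanTreeSize (α : ℝ) (n : ℕ) :
    expectedTreeVertices (⊤ : SimpleGraph (Fin (n + 1))) (α / ((n + 1 : ℕ) : ℝ)) 0 =
      meanTreeSize α (n + 1) := by
  rw [expectedTreeVertices_eq, meanTreeSize, treeSum, Nat.add_sub_cancel]

lemma isEquivalent_of_tendsto_div {u v g : ℕ → ℝ} {L : ℝ} (hL : L ≠ 0)
    (h : Tendsto (fun n => u n / g n) atTop (𝓝 L)) (hg : ∀ᶠ n in atTop, g n ≠ 0)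
    (hv : ∀ᶠ n in atTop, v n = L * g n) : u ~[atTop] v := by
  have h1 := ((isEquivalent_const_iff_tendsto hL).2 h).mul (IsEquivalent.refl (u := g))
  refine (h1.congr_left ?_).congr_right ?_
  · filter_upwards [hg] with n hn
    exact div_mul_cancel₀ _ hn
  · filter_upwards [hv] with n hn
    exact hn.symm

lemma isEquivalent_comp_add {u v : ℕ → ℝ} (h : u ~[atTop] v) (k : ℕ) :
    (fun n => u (n + k)) ~[atTop] fun n => v (n + k) :=
  h.comp_tendsto (tendsto_add_atTop_nat k)

variable {α : ℝ}

lemma expectedTreeVertices_isEquivalent {g : ℕ → ℝ} (h : meanTreeSize α ~[atTop] g) :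
    (fun n : ℕ => expectedTreeVertices (⊤ : SimpleGraph (Fin (n + 1))) (α / ((n + 1 : ℕ) : ℝ)) 0)
      ~[atTop] fun n => g (n + 1) := by
  simp only [expectedTreeVertices_eq_meanTreeSize]
  exact isEquivalent_comp_add h 1

lemma expectedTreeEdges_isEquivalent (hα : 0 < α) {g : ℕ → ℝ}
    (h : (fun N => meanTreeSize α N - 1) ~[atTop] g) :
    (fun n : ℕ => expectedTreeEdges (⊤ : SimpleGraph (Fin (n + 1))) (α / ((n + 1 : ℕ) : ℝ)) 0)
      ~[atTop] fun n => g (n + 1) := by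
  have e : ∀ n : ℕ, expectedTreeEdges (⊤ : SimpleGraph (Fin (n + 1))) (α / ((n + 1 : ℕ) : ℝ)) 0 =
      meanTreeSize α (n + 1) - 1 := fun n => by
    rw [expectedTreeEdges_eq _ (by positivity), expectedTreeVertices_eq_meanTreeSize]
  simp only [e]
  exact isEquivalent_comp_add h 1

lemma connProb_isEquivalent (hα : 0 < α) {g : ℕ → ℝ}
    (h : (fun N => meanTreeSize α N - 1) ~[atTop] g) :
    (fun n : ℕ => connProb (⊤ : SimpleGraph (Fin (n + 2))) (α / ((n + 2 : ℕ) : ℝ)) 0 1)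
      ~[atTop] fun n => g (n + 2) / ((n + 2 : ℕ) : ℝ) := by
  have e : ∀ n : ℕ, connProb (⊤ : SimpleGraph (Fin (n + 2))) (α / ((n + 2 : ℕ) : ℝ)) 0 1 =
      (meanTreeSize α (n + 2) - 1) / (n + 1) := fun n => by
    rw [connProb_eq (by positivity)]
    congr 2
    exact expectedTreeVertices_eq_meanTreeSize α (n + 1)
  simp only [e]
  refine (isEquivalent_comp_add h 2).div ?_
  -- The exact denominator is N - 1, the asserted one is N.
  have h1 : Tendsto (fun n : ℕ => ((n : ℝ) + 1) / ((n + 2 : ℕ) : ℝ)) atTop (𝓝 1) := by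
    have h2 : Tendsto (fun n : ℕ => 1 - 1 / ((n + 2 : ℕ) : ℝ)) atTop (𝓝 (1 - 0)) :=
      (tendsto_const_nhds.div_atTop
        (tendsto_natCast_atTop_atTop.comp (tendsto_add_atTop_nat 2))).const_sub 1
    rw [sub_zero] at h2
    refine h2.congr fun n => ?_
    have : ((n : ℝ) + 2) ≠ 0 := by positivity
    push_cast
    field_simp
    ring
  exact isEquivalent_of_tendsto_div one_ne_zero h1 (Eventually.of_forall fun n => by positivity)
    (Eventually.of_forall fun n => (one_mul _).symm)

lemma isEquivalent_sub_one {u g : ℕ → ℝ} (h : u ~[atTop] g) (hg : Tendsto g atTop atTop) :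
    (fun n => u n - 1) ~[atTop] g := by
  refine h.sub_isLittleO ?_
  exact isLittleO_const_left.2 (Or.inr (tendsto_norm_atTop_atTop.comp hg))

/-- The tree size stays bounded, so the 1 subtracted for edges and connections is not negligible;
the limit itself is recorded for that purpose. -/
theorem subcritical (hα : 0 < α) (hα1 : α < 1) :
    ((fun N : ℕ => partitionFunction (⊤ : SimpleGraph (Fin N)) (α / (N : ℝ)))
      ~[atTop] fun N : ℕ => Real.exp ((N : ℝ) * α / 2) * Real.sqrt (1 - α)) ∧
    Tendsto (meanTreeSize α) atTop (𝓝 (1 / (1 - α))) := by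
  have h1 : 0 < 1 - α := by linarith
  have hs : √(1 - α) ≠ 0 := (Real.sqrt_pos.2 h1).ne'
  have hZ := tendsto_partitionFunction_subcritical hα hα1
  refine ⟨isEquivalent_of_tendsto_div hs hZ (Eventually.of_forall fun N => (Real.exp_pos _).ne')
    (Eventually.of_forall fun N => mul_comm _ _), ?_⟩
  have h := (tendsto_treeSum_subcritical hα hα1).div hZ hs
  have e : 1 / √(1 - α) / √(1 - α) = 1 / (1 - α) := by
    rw [div_div, Real.mul_self_sqrt h1.le]
  rw [e] at h
  refine h.congr fun N => ?_
  have := (Real.exp_pos (N * α / 2)).ne'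
  rw [Pi.div_apply, meanTreeSize, div_div_div_cancel_right₀ this]

theorem supercritical (hα : 1 < α) :
    ((fun N : ℕ => partitionFunction (⊤ : SimpleGraph (Fin N)) (α / (N : ℝ)))
      ~[atTop] fun N : ℕ => α ^ ((N : ℝ) + 3 / 2) * Real.exp ((N : ℝ) / (2 * α)) /
        ((α - 1) ^ (5 / 2 : ℝ) * (N : ℝ))) ∧
    (meanTreeSize α ~[atTop] fun N => ((α - 1) / α) ^ 2 * N) := by
  have h0 : 0 < α := by linarith
  have h1 : 0 < α - 1 := by linarith
  have hpos : 0 < 1 - α / α ^ 2 := by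
    have : 1 - α / α ^ 2 = (α - 1) / α := by field_simp
    rw [this]; positivity
  have hs : √(1 - α / α ^ 2) ≠ 0 := (Real.sqrt_pos.2 hpos).ne'
  have hZ := tendsto_partitionFunction_supercritical hα
  have hL : α * ((α - 1)⁻¹) ^ 2 / √(1 - α / α ^ 2) ≠ 0 := by positivity
  have hg : ∀ N : ℕ, α ^ N * Real.exp (N / (2 * α)) ≠ 0 := fun N => by positivity
  constructor
  · refine isEquivalent_of_tendsto_div (g := fun N : ℕ => α ^ N * Real.exp (N / (2 * α)) / N) hL
      (hZ.congr fun N => ?_) ?_ ?_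
    · rw [div_div_eq_mul_div, mul_comm (N : ℝ)]
    · filter_upwards [eventually_gt_atTop 0] with N hN
      have : (0 : ℝ) < N := by exact_mod_cast hN
      positivity
    · refine Eventually.of_forall fun N => ?_
      have e1 : 1 - α / α ^ 2 = (α - 1) / α := by field_simp
      have e2 : α ^ ((N : ℝ) + 3 / 2) = α ^ N * (α * √α) := by
        rw [Real.rpow_add h0, Real.rpow_natCast, Real.sqrt_eq_rpow, ← Real.rpow_one_add' h0.le]
        · norm_num
        · norm_num
      have e3 : (α - 1) ^ (5 / 2 : ℝ) = (α - 1) ^ 2 * √(α - 1) := by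
        rw [Real.sqrt_eq_rpow, ← Real.rpow_natCast, ← Real.rpow_add h1]; norm_num
      have hs1 := (Real.sqrt_pos.2 h0).ne'
      have hs2 := (Real.sqrt_pos.2 h1).ne'
      rw [e1, e2, e3, Real.sqrt_div h1.le]
      field_simp
  · have h := (tendsto_treeSum_supercritical hα).div hZ hL
    have e : α⁻¹ / √(1 - α / α ^ 2) / (α * ((α - 1)⁻¹) ^ 2 / √(1 - α / α ^ 2)) =
        ((α - 1) / α) ^ 2 := by
      rw [div_div_div_cancel_right₀ hs]
      field_simp
    rw [e] at h
    refine isEquivalent_of_tendsto_div (L := ((α - 1) / α) ^ 2) (g := fun N : ℕ => (N : ℝ))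
      (by positivity) (h.congr fun N => ?_) ?_ (Eventually.of_forall fun N => rfl)
    · rw [Pi.div_apply, div_div_div_cancel_right₀ (hg N), meanTreeSize, div_div, mul_comm]
    · filter_upwards [eventually_gt_atTop 0] with N hN
      exact_mod_cast hN.ne'

theorem critical :
    ((fun N : ℕ => partitionFunction (⊤ : SimpleGraph (Fin N)) (1 / (N : ℝ)))
      ~[atTop] fun N : ℕ => (3 : ℝ) ^ (1 / 6 : ℝ) * Real.Gamma (2 / 3) * Real.exp ((N : ℝ) / 2) /
        ((N : ℝ) ^ (1 / 6 : ℝ) * Real.sqrt (2 * Real.pi))) ∧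
    (meanTreeSize 1 ~[atTop] fun N =>
      (3 : ℝ) ^ (2 / 3 : ℝ) * Real.Gamma (4 / 3) / Real.Gamma (2 / 3) * (N : ℝ) ^ (1 / 3 : ℝ)) := by
  have hZ := tendsto_partitionFunction_critical
  have hG : 0 < Real.Gamma (2 / 3) := Real.Gamma_pos_of_pos (by norm_num)
  have hG' : 0 < Real.Gamma (4 / 3) := Real.Gamma_pos_of_pos (by norm_num)
  have hL : (3 : ℝ) ^ (1 / 6 : ℝ) * Real.Gamma (2 / 3) / √(2 * π) ≠ 0 := by positivity
  constructor
  · refine isEquivalent_of_tendsto_div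
      (g := fun N : ℕ => Real.exp (N / 2) / (N : ℝ) ^ (1 / 6 : ℝ)) hL (hZ.congr' ?_) ?_ ?_
    · filter_upwards [eventually_gt_atTop 0] with N hN
      have hN' : (0 : ℝ) < N := by exact_mod_cast hN
      have e : (N : ℝ) ^ (1 / 3 : ℝ) = (N : ℝ) ^ (1 / 6 : ℝ) * (N : ℝ) ^ (1 / 6 : ℝ) := by
        rw [← Real.rpow_add hN']; norm_num
      have h6 := (Real.rpow_pos_of_pos hN' (1 / 6)).ne'
      rw [e]
      field_simp
    · filter_upwards [eventually_gt_atTop 0] with N hN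
      have hN' : (0 : ℝ) < N := by exact_mod_cast hN
      positivity
    · refine Eventually.of_forall fun N => ?_
      ring
  · have h := tendsto_treeSum_critical.div hZ hL
    have e : (3 : ℝ) ^ (5 / 6 : ℝ) * Real.Gamma (4 / 3) / √(2 * π) /
        (3 ^ (1 / 6 : ℝ) * Real.Gamma (2 / 3) / √(2 * π)) =
        (3 : ℝ) ^ (2 / 3 : ℝ) * Real.Gamma (4 / 3) / Real.Gamma (2 / 3) := by
      have e5 : (3 : ℝ) ^ (5 / 6 : ℝ) = 3 ^ (1 / 6 : ℝ) * 3 ^ (2 / 3 : ℝ) := by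
        rw [← Real.rpow_add (by norm_num)]; norm_num
      have hpi : √(2 * π) ≠ 0 := by positivity
      rw [div_div_div_cancel_right₀ hpi, e5]
      have h3 : (3 : ℝ) ^ (1 / 6 : ℝ) ≠ 0 := by positivity
      rw [mul_assoc, mul_div_mul_left _ _ h3]
    rw [e] at h
    refine isEquivalent_of_tendsto_div (g := fun N : ℕ => (N : ℝ) ^ (1 / 3 : ℝ))
      (by positivity) (h.congr' ?_) ?_ (Eventually.of_forall fun N => rfl)
    · filter_upwards [eventually_gt_atTop 0] with N hN
      have hN' : (0 : ℝ) < N := by exact_mod_cast hN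
      have hg : (N : ℝ) ^ (1 / 6 : ℝ) * Real.exp (N / 2) ≠ 0 := by positivity
      rw [Pi.div_apply, div_div_div_cancel_right₀ hg, meanTreeSize, div_div, mul_comm]
    · filter_upwards [eventually_gt_atTop 0] with N hN
      have hN' : (0 : ℝ) < N := by exact_mod_cast hN
      positivity

end Conclusion

end ArborealGas
end

/-- Arboreal gas on the complete graph `K_N` with vertex set `Fin N = {0, …, N - 1}` and parameter
`β = α / N`, as `N → ∞` for a fixed `α > 0`. So that the vertices `0` and `1` exist and are distinct,
the claims on `0 ↔ 1` are indexed by `N = n + 2`, those on the tree `T_0` by `N = n + 1`. -/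
theorem mainTheorem3 (α : ℝ) (hα : 0 < α) :
    (α < 1 →
      ((fun N : ℕ => ArborealGas.partitionFunction (⊤ : SimpleGraph (Fin N)) (α / (N : ℝ)))
        ~[atTop] fun N : ℕ => Real.exp ((N : ℝ) * α / 2) * Real.sqrt (1 - α)) ∧
      ((fun n : ℕ => ArborealGas.connProb (⊤ : SimpleGraph (Fin (n + 2)))
          (α / ((n + 2 : ℕ) : ℝ)) 0 1)
        ~[atTop] fun n : ℕ => α / (1 - α) * (1 / ((n + 2 : ℕ) : ℝ))) ∧
      ((fun n : ℕ => ArborealGas.expectedTreeEdges (⊤ : SimpleGraph (Fin (n + 1)))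
          (α / ((n + 1 : ℕ) : ℝ)) 0)
        ~[atTop] fun _ : ℕ => α / (1 - α)) ∧
      ((fun n : ℕ => ArborealGas.expectedTreeVertices (⊤ : SimpleGraph (Fin (n + 1)))
          (α / ((n + 1 : ℕ) : ℝ)) 0)
        ~[atTop] fun _ : ℕ => 1 / (1 - α))) ∧
    (1 < α →
      ((fun N : ℕ => ArborealGas.partitionFunction (⊤ : SimpleGraph (Fin N)) (α / (N : ℝ)))
        ~[atTop] fun N : ℕ => α ^ ((N : ℝ) + 3 / 2) * Real.exp ((N : ℝ) / (2 * α)) /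
          ((α - 1) ^ (5 / 2 : ℝ) * (N : ℝ))) ∧
      ((fun n : ℕ => ArborealGas.connProb (⊤ : SimpleGraph (Fin (n + 2)))
          (α / ((n + 2 : ℕ) : ℝ)) 0 1)
        ~[atTop] fun _ : ℕ => ((α - 1) / α) ^ 2) ∧
      ((fun n : ℕ => ArborealGas.expectedTreeEdges (⊤ : SimpleGraph (Fin (n + 1)))
          (α / ((n + 1 : ℕ) : ℝ)) 0)
        ~[atTop] fun n : ℕ => ((α - 1) / α) ^ 2 * ((n + 1 : ℕ) : ℝ)) ∧
      ((fun n : ℕ => ArborealGas.expectedTreeVertices (⊤ : SimpleGraph (Fin (n + 1)))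
          (α / ((n + 1 : ℕ) : ℝ)) 0)
        ~[atTop] fun n : ℕ => ((α - 1) / α) ^ 2 * ((n + 1 : ℕ) : ℝ))) ∧
    (α = 1 →
      ((fun N : ℕ => ArborealGas.partitionFunction (⊤ : SimpleGraph (Fin N)) (α / (N : ℝ)))
        ~[atTop] fun N : ℕ =>
          (3 : ℝ) ^ (1 / 6 : ℝ) * Real.Gamma (2 / 3) * Real.exp ((N : ℝ) / 2) /
            ((N : ℝ) ^ (1 / 6 : ℝ) * Real.sqrt (2 * Real.pi))) ∧
      ((fun n : ℕ => ArborealGas.connProb (⊤ : SimpleGraph (Fin (n + 2)))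
          (α / ((n + 2 : ℕ) : ℝ)) 0 1)
        ~[atTop] fun n : ℕ =>
          (3 : ℝ) ^ (2 / 3 : ℝ) * Real.Gamma (4 / 3) / Real.Gamma (2 / 3) *
            (1 / ((n + 2 : ℕ) : ℝ) ^ (2 / 3 : ℝ))) ∧
      ((fun n : ℕ => ArborealGas.expectedTreeEdges (⊤ : SimpleGraph (Fin (n + 1)))
          (α / ((n + 1 : ℕ) : ℝ)) 0)
        ~[atTop] fun n : ℕ =>
          (3 : ℝ) ^ (2 / 3 : ℝ) * Real.Gamma (4 / 3) / Real.Gamma (2 / 3) *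
            ((n + 1 : ℕ) : ℝ) ^ (1 / 3 : ℝ)) ∧
      ((fun n : ℕ => ArborealGas.expectedTreeVertices (⊤ : SimpleGraph (Fin (n + 1)))
          (α / ((n + 1 : ℕ) : ℝ)) 0)
        ~[atTop] fun n : ℕ =>
          (3 : ℝ) ^ (2 / 3 : ℝ) * Real.Gamma (4 / 3) / Real.Gamma (2 / 3) *
            ((n + 1 : ℕ) : ℝ) ^ (1 / 3 : ℝ))) := by
  refine ⟨fun h => ?_, fun h => ?_, fun h => ?_⟩
  · obtain ⟨hZ, hR⟩ := ArborealGas.subcritical hα h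
    have h1 : 0 < 1 - α := by linarith
    have hV : ArborealGas.meanTreeSize α ~[atTop] fun _ => 1 / (1 - α) :=
      (isEquivalent_const_iff_tendsto (by positivity)).2 hR
    have hE : (fun N => ArborealGas.meanTreeSize α N - 1) ~[atTop] fun _ => α / (1 - α) := by
      refine (isEquivalent_const_iff_tendsto (by positivity)).2 ?_
      have e : α / (1 - α) = 1 / (1 - α) - 1 := by field_simp; ring
      rw [e]
      exact hR.sub_const 1
    refine ⟨hZ, ?_, ArborealGas.expectedTreeEdges_isEquivalent hα hE,
      ArborealGas.expectedTreeVertices_isEquivalent hV⟩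
    refine (ArborealGas.connProb_isEquivalent hα hE).congr_right (Eventually.of_forall fun n => ?_)
    exact (mul_one_div _ _).symm
  · obtain ⟨hZ, hV⟩ := ArborealGas.supercritical h
    have h1 : 0 < α - 1 := by linarith
    have hE := ArborealGas.isEquivalent_sub_one hV
      (tendsto_natCast_atTop_atTop.const_mul_atTop (by positivity))
    refine ⟨hZ, ?_, ArborealGas.expectedTreeEdges_isEquivalent hα hE,
      ArborealGas.expectedTreeVertices_isEquivalent hV⟩
    refine (ArborealGas.connProb_isEquivalent hα hE).congr_right (Eventually.of_forall fun n => ?_)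
    exact mul_div_cancel_right₀ _ (by positivity)
  · subst h
    obtain ⟨hZ, hV⟩ := ArborealGas.critical
    have hc : 0 < (3 : ℝ) ^ (2 / 3 : ℝ) * Real.Gamma (4 / 3) / Real.Gamma (2 / 3) := by
      have hG : 0 < Real.Gamma (2 / 3) := Real.Gamma_pos_of_pos (by norm_num)
      have hG' : 0 < Real.Gamma (4 / 3) := Real.Gamma_pos_of_pos (by norm_num)
      positivity
    have hE := ArborealGas.isEquivalent_sub_one hV
      (((tendsto_rpow_atTop (by norm_num)).comp tendsto_natCast_atTop_atTop).const_mul_atTop hc)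
    refine ⟨hZ, ?_, ArborealGas.expectedTreeEdges_isEquivalent hα hE,
      ArborealGas.expectedTreeVertices_isEquivalent hV⟩
    refine (ArborealGas.connProb_isEquivalent hα hE).congr_right (Eventually.of_forall fun n => ?_)
    have hN : (0 : ℝ) < ((n + 2 : ℕ) : ℝ) := by positivity
    dsimp only
    rw [mul_div_assoc]
    congr 1
    rw [← Real.rpow_sub_one hN.ne', one_div (_ ^ _), ← Real.rpow_neg hN.le]
    norm_num
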